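/- Let $T$ be a finite tree with at least $2$ vertices, with $\ell(T)$ leaves (vertices of degree $1$) and edge set $E(T)$. An arithmetical structure on $T$ is a pair $(\mathbf d,\mathbf r)$ of integer vectors indexed by $V(T)$ such that $\mathbf d$ has nonnegative entries, $\mathbf r$ has positive entries with no nontrivial common factor, and $(\operatorname{diag}(\mathbf d)-A(T))\,\mathbf r=\mathbf 0$, where $A(T)$ is the adjacency matrix. Its critical group is the torsion subgroup of $\mathbb Z^{V(T)}/\operatorname{im}(\operatorname{diag}(\mathbf d)-A(T))$. The number of invariant factors of a finite abelian group $K$ is the integer $k\ge 0$ for which $K\cong\mathbb Z/a_1\oplus\cdots\oplus\mathbb Z/a_k$ with all $a_i>1$ and $a_1\mid a_2\mid\cdots\mid a_k$. The $2$-matching number $\nu_2(T)$ is the largest size of a set of edges such that every vertex is incident to at most two edges of the set. A starlike tree is a tree with exactly one vertex (its central vertex) of degree at least $3$. If a tree has more than one vertex of degree at least $3$, a starlike splitting of it is a tuple $(S,T',v_s,v_t)$ in which $S$ is a starlike tree, $T'$ is a tree, $v_s$ is a leaf of $S$ adjacent to the central vertex of $S$, $v_t$ is a vertex of $T'$, and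 the given tree is obtained from $S$ and $T'$ by merging $v_s$ and $v_t$. The splitting is regular if $v_t$ has degree $1$ in $T'$, and irregular if $v_t$ has degree greater than $1$ in $T'$. A starlike decomposition of $T$ is obtained by a sequence of starlike splittings, first of $T$ and then always of the remaining tree $T'$, until a tree with at most one vertex of degree at least $3$ remains. The splitting irregularity number $\iota(T)$ is the number of irregular splittings in any such sequence. Then such sequences exist, all of them have the same number of irregular splittings (so $\iota(T)$ is well defined), $\ell(T)-2-\iota(T)=|E(T)|-\nu_2(T)$, and: (a) the number of invariant factors of the critical group of any arithmetical structure on $T$ is at most $\ell(T)-2-\iota(T)$, or equivalently at most $|E(T)|-\nu_2(T)$; (b) for every integer $t$ with $0\le t\le \ell(T)-2-\iota(T)$ there is an arithmetical structure on $T$ whose critical group has exactly $t$ invariant factors. -/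

import Mathlib

universe u

namespace SimpleGraph

/-- The degree of a vertex, as the number of its neighbours. -/
noncomputable def vertexDegree {V : Type u} (G : SimpleGraph V) (v : V) : ℕ :=
  (G.neighborSet v).ncard

/-- For a locally finite graph this is the usual degree. -/
theorem vertexDegree_eq_degree {V : Type u} (G : SimpleGraph V) (v : V)
    [Fintype (G.neighborSet v)] : G.vertexDegree v = G.degree v := by
  rw [vertexDegree, Set.ncard_eq_toFinset_card']
  rfl

/-- The number of leaves, i.e. of vertices of degree one. -/
noncomputable def leafCount {V : Type u} (G : SimpleGraph V) : ℕ :=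
  {v : V | G.vertexDegree v = 1}.ncard

/-! ### Arithmetical structures and critical groups -/

/-- The generalized Laplacian matrix `diag(d) - A(G)`. -/
def generalizedLaplacian {V : Type u} [DecidableEq V] (G : SimpleGraph V)
    [DecidableRel G.Adj] (d : V → ℤ) : Matrix V V ℤ :=
  Matrix.diagonal d - G.adjMatrix ℤ

/-- An arithmetical structure `(d, r)` on `G`: the entries of `d` are nonnegative, the entries
of `r` are positive with no nontrivial common factor, and `(diag(d) - A(G)) r = 0`. -/
structure ArithmeticalStructure {V : Type u} [Fintype V] [DecidableEq V] (G : SimpleGraph V)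
    [DecidableRel G.Adj] where
  d : V → ℤ
  r : V → ℤ
  d_nonneg : ∀ v, 0 ≤ d v
  r_pos : ∀ v, 0 < r v
  r_coprime : ∀ m : ℤ, (∀ v, m ∣ r v) → IsUnit m
  laplacian_mulVec : (G.generalizedLaplacian d).mulVec r = 0

/-- The critical group: the torsion part of the cokernel of the generalized Laplacian matrix
acting on `ℤ^V`. -/
abbrev ArithmeticalStructure.criticalGroup {V : Type u} [Fintype V] [DecidableEq V]
    {G : SimpleGraph V} [DecidableRel G.Adj] (A : G.ArithmeticalStructure) :
    Submodule ℤ ((V → ℤ) ⧸ LinearMap.range (G.generalizedLaplacian A.d).mulVecLin) :=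
  Submodule.torsion ℤ ((V → ℤ) ⧸ LinearMap.range (G.generalizedLaplacian A.d).mulVecLin)

/-! ### Starlike splittings -/

/-- A starlike tree: a tree with exactly one vertex of degree at least three. -/
def IsStarlike {V : Type u} (G : SimpleGraph V) : Prop :=
  G.IsTree ∧ ∃! c, 3 ≤ G.vertexDegree c

/-- `(S, T', s, t)` is a starlike splitting of the tree `T`, where `T` has several vertices of
degree at least three: `S` is starlike, `T'` is a tree, `s` is a leaf of `S` adjacent to the
central vertex of `S`, `t` is a vertex of `T'`, and `T` arises from `S` and `T'` by merging `s`
and `t` (that is, `T` is the union of the subgraphs `S` and `T'`, which share only the vertex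
`s = t`). -/
structure IsStarlikeSplitting {V : Type u} (T : SimpleGraph V) (S T' : T.Subgraph)
    (s : S.verts) (t : T'.verts) : Prop where
  isTree : T.IsTree
  not_starlike : ∃ u w, u ≠ w ∧ 3 ≤ T.vertexDegree u ∧ 3 ≤ T.vertexDegree w
  starlike_left : S.coe.IsStarlike
  isTree_right : T'.coe.IsTree
  leaf : S.coe.vertexDegree s = 1
  adj_center : ∃ c, 3 ≤ S.coe.vertexDegree c ∧ S.coe.Adj s c
  merged : (s : V) = t
  inter : S.verts ∩ T'.verts = {(s : V)}
  union : S ⊔ T' = ⊤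

/-- `T.HasIrregularSplittings n`: some sequence of starlike splittings, starting from the tree
`T`, always splitting the remaining tree `T'` further, and ending with a tree that has at most one
vertex of degree at least three, contains exactly `n` irregular splittings. A splitting
`(S, T', s, t)` is regular if `t` has degree one in `T'` and irregular if it has larger degree. -/
inductive HasIrregularSplittings : ∀ {V : Type u}, SimpleGraph V → ℕ → Prop
  | done {V : Type u} {T : SimpleGraph V} (isTree : T.IsTree)
      (h : ∀ u w, 3 ≤ T.vertexDegree u → 3 ≤ T.vertexDegree w → u = w) :
      HasIrregularSplittings T 0
  | regular {V : Type u} {T : SimpleGraph V} {S T' : T.Subgraph} {s : S.verts} {t : T'.verts}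
      {n : ℕ} (h : T.IsStarlikeSplitting S T' s t) (ht : T'.coe.vertexDegree t = 1)
      (rest : HasIrregularSplittings T'.coe n) : HasIrregularSplittings T n
  | irregular {V : Type u} {T : SimpleGraph V} {S T' : T.Subgraph} {s : S.verts} {t : T'.verts}
      {n : ℕ} (h : T.IsStarlikeSplitting S T' s t) (ht : 1 < T'.coe.vertexDegree t)
      (rest : HasIrregularSplittings T'.coe n) : HasIrregularSplittings T (n + 1)

/-- The splitting irregularity number: the number of irregular splittings in a sequence of
starlike splittings decomposing `T`. It is recorded as the least such number; that every
sequence gives the same number is a theorem for finite trees, not part of the definition. -/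
noncomputable def splittingIrregularityNumber {V : Type u} (T : SimpleGraph V) : ℕ :=
  sInf {n | T.HasIrregularSplittings n}

/-! ### Two-matchings -/

/-- A 2-matching: a set of edges such that every vertex is incident to at most two of them. -/
def IsTwoMatching {V : Type u} (G : SimpleGraph V) (M : Set (Sym2 V)) : Prop :=
  M ⊆ G.edgeSet ∧ ∀ v : V, {e ∈ M | v ∈ e}.ncard ≤ 2

/-- The 2-matching number: the maximum cardinality of a 2-matching (of a finite graph). -/
noncomputable def twoMatchingNumber {V : Type u} (G : SimpleGraph V) : ℕ :=
  sSup {n | ∃ M, G.IsTwoMatching M ∧ M.ncard = n}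

/-- In a finite graph the supremum in the definition is an attained maximum. -/
theorem isGreatest_twoMatchingNumber {V : Type u} [Finite V] (G : SimpleGraph V) :
    IsGreatest {n | ∃ M, G.IsTwoMatching M ∧ M.ncard = n} G.twoMatchingNumber := by
  have hb : BddAbove {n | ∃ M, G.IsTwoMatching M ∧ M.ncard = n} := by
    refine ⟨G.edgeSet.ncard, ?_⟩
    rintro n ⟨M, hM, rfl⟩
    exact Set.ncard_le_ncard hM.1 (Set.toFinite _)
  refine ⟨Nat.sSup_mem ⟨0, ∅, ⟨Set.empty_subset _, fun v => by simp⟩, by simp⟩ hb, ?_⟩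
  exact fun n hn => le_csSup hb hn

end SimpleGraph

/-- The abelian group `K` has exactly `k` invariant factors: `K ≅ ℤ/a₁ ⊕ ⋯ ⊕ ℤ/aₖ` with all
`aᵢ > 1` and `a₁ ∣ a₂ ∣ ⋯ ∣ aₖ`. -/
def HasInvariantFactorCount (K : Type u) [AddCommGroup K] (k : ℕ) : Prop :=
  ∃ a : Fin k → ℕ, (∀ i, 1 < a i) ∧ (∀ i j, i ≤ j → a i ∣ a j) ∧
    Nonempty (K ≃+ ((i : Fin k) → ZMod (a i)))

/-! ### Invariant factors of finite abelian groups -/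

/-! Root the tree at a leaf `ρ` and let `Q` be its branch set. Writing `f v` for the number of
children of `v` outside `Q`, everything is compared with `branchExcess`, the sum of `f v - 1` over
`Q`. It equals the number of edges minus the 2-matching number: each `v ∈ Q` forces `f v - 1`
omitted edges among its parent edge and the edges to its free children, and omitting exactly these
suffices (`twoMatchingNumber_add_branchExcess`).

For (a), the cokernel of the Laplacian is `ℤ × K` with `K` the critical group (`exists_equiv`), and
homomorphisms from it to a ring are the kernel vectors of the Laplacian over that ring. Modulo a
prime dividing every invariant factor these form a space of dimension `k + 1`, where `k` is the
number of factors. Over any commutative ring they are determined by `branchExcess + 1` of their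
entries (`exists_determining_finset`), so `k ≤ branchExcess`.

For (b), split `t` as a sum of `j v ≤ f v - 1` over `Q` and take `r` to consist of powers of two:
`r` grows by `2 ^ (j v + 1)` from the parent of `v` to `v`, and the free children of `v` carry the
factors `1, 2, 4, ...`, capped at `2 ^ (j v + 1)`, relative to that parent. Kernel vectors of this
structure are determined over any commutative ring by `t + 1` entries, and modulo 2 these entries
are arbitrary, so there are exactly `t` factors.

For the irregularity number, each splitting preserves `ν₂ + ∑ (deg - 2) - |E|`, with truncated
subtraction in the sum, except that an irregular one contributes 1
(`HasIrregularSplittings.twoMatchingNumber_add`). As the sum is the number of leaves minus 2, the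
count of irregular splittings is the same for all sequences. Sequences exist because a branching
vertex of maximal depth can always be cut off with its subtree. -/

theorem exists_invariantFactors_pi {ι : Type} [Fintype ι] (p e : ι → ℕ) (hp : ∀ i, (p i).Prime)
    (he : ∀ i, e i ≠ 0) :
    ∃ (k : ℕ) (a : Fin k → ℕ), (∀ i, 1 < a i) ∧ (∀ i j, i ≤ j → a i ∣ a j) ∧
      (∀ m, (∀ i, p i ^ e i ∣ m) → ∀ j, a j ∣ m) ∧
      Nonempty (((i : ι) → ZMod (p i ^ e i)) ≃+ ((j : Fin k) → ZMod (a j))) := by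
  classical
  induction hn : Fintype.card ι using Nat.strong_induction_on generalizing ι with
  | _ n ih =>
  rcases isEmpty_or_nonempty ι with hι | ⟨⟨i₀⟩⟩
  · exact ⟨0, Fin.elim0, fun i => i.elim0, fun i => i.elim0, fun _ _ i => i.elim0,
      ⟨{ Equiv.ofUnique _ _ with map_add' := fun _ _ => Subsingleton.elim _ _ }⟩⟩
  -- For each prime that occurs, select one factor of maximal exponent. By the Chinese remainder
  -- theorem the selected factors form `ZMod m₀`, the last invariant factor; induction handles the
  -- others. `i₀` is only a default for values `q` that do not occur.
  have hmax : ∀ q : ℕ, ∃ j : ι, (∃ i, p i = q) → p j = q ∧ ∀ l, p l = q → e l ≤ e j := by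
    intro q
    by_cases h : ∃ i, p i = q
    · obtain ⟨i, hi⟩ := h
      obtain ⟨j, hj, hj'⟩ := Finset.exists_max_image (Finset.univ.filter fun i => p i = q) e
        ⟨i, by simpa using hi⟩
      exact ⟨j, fun _ => ⟨by simpa using hj, fun l hl => hj' l (by simpa using hl)⟩⟩
    · exact ⟨i₀, fun h' => absurd h' h⟩
  choose pick hpick using hmax
  let P : ι → Prop := fun i => pick (p i) = i
  have hPp : ∀ i, p (pick (p i)) = p i := fun i => (hpick (p i) ⟨i, rfl⟩).1
  have hPick : ∀ i, P (pick (p i)) := fun i => by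
    change pick (p (pick (p i))) = _
    rw [hPp]
  have hcop : Pairwise (Function.onFun Nat.Coprime fun i : {i // P i} => p i ^ e i) := by
    intro i j hij
    refine Nat.Coprime.pow _ _ ((Nat.coprime_primes (hp _) (hp _)).2 fun h => hij ?_)
    apply Subtype.ext
    rw [← i.2, ← j.2, h]
  set m₀ : ℕ := ∏ i : {i // P i}, p i ^ e i with hm₀
  have hdvd : ∀ i, p i ^ e i ∣ m₀ := by
    intro i
    have h1 : p i ^ e i ∣ p (pick (p i)) ^ e (pick (p i)) := by
      rw [hPp]
      exact pow_dvd_pow _ ((hpick (p i) ⟨i, rfl⟩).2 i rfl)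
    exact h1.trans (Finset.dvd_prod_of_mem (fun i : {i // P i} => p i ^ e i)
      (Finset.mem_univ (⟨_, hPick i⟩ : {i // P i})))
  have hm₀1 : 1 < m₀ := by
    have h1 : 1 < p i₀ ^ e i₀ := Nat.one_lt_pow (he _) (hp _).one_lt
    have h0 : 0 < m₀ := Finset.prod_pos fun i _ => pow_pos (hp _).pos _
    exact h1.trans_le (Nat.le_of_dvd h0 (hdvd i₀))
  obtain ⟨k, a, ha1, hchain, hdiv, ⟨f⟩⟩ := ih (Fintype.card {i // ¬ P i})
    (by
      rw [← hn]
      exact Fintype.card_subtype_lt (x := pick (p i₀)) (by simpa using hPick i₀))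
    (fun i : {i // ¬ P i} => p i) (fun i => e i) (fun i => hp _) (fun i => he _) rfl
  -- The clause on common multiples is carried through the induction for this step: it extends the
  -- divisibility chain by `m₀`.
  have ham : ∀ j, a j ∣ m₀ := hdiv m₀ fun i => hdvd i
  refine ⟨k + 1, Fin.snoc a m₀, ?_, ?_, ?_, ?_⟩
  · intro i
    refine Fin.lastCases ?_ (fun i => ?_) i
    · simpa using hm₀1
    · simpa using ha1 i
  · intro i j
    refine Fin.lastCases ?_ (fun j => ?_) j
    · refine Fin.lastCases (fun _ => ?_) (fun i _ => ?_) i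
      · simp
      · simpa using ham i
    · refine Fin.lastCases (fun h => ?_) (fun i h => ?_) i
      · exact absurd h (not_le.2 (Fin.castSucc_lt_last j))
      · simpa using hchain i j (by simpa using h)
  · intro m hm j
    refine Fin.lastCases ?_ (fun j => ?_) j
    · simp only [Fin.snoc_last]
      exact Finset.prod_dvd_of_isRelPrime
        (fun i _ j _ hij => Nat.coprime_iff_isRelPrime.1 (hcop hij)) fun i _ => hm i
    · simpa using hdiv m (fun i => hm i) j
  · let g₁ : ((i : ι) → ZMod (p i ^ e i)) ≃+
        ((i : {i // P i}) → ZMod (p i ^ e i)) × ((i : {i // ¬ P i}) → ZMod (p i ^ e i)) :=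
      { Equiv.piEquivPiSubtypeProd P fun i => ZMod (p i ^ e i) with map_add' := fun _ _ => rfl }
    let b : Fin (k + 1) → ℕ := Fin.snoc a m₀
    let g₂ : ((i : Fin (k + 1)) → ZMod (b i)) ≃+
        ZMod (b (Fin.last k)) × ((i : Fin k) → ZMod (b i.castSucc)) :=
      { (Fin.snocEquiv fun i => ZMod (b i)).symm with map_add' := fun _ _ => rfl }
    let g₃ : ((i : {i // P i}) → ZMod (p i ^ e i)) ≃+ ZMod (b (Fin.last k)) :=
      (ZMod.prodEquivPi (fun i : {i // P i} => p i ^ e i) hcop).symm.toAddEquiv.trans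
        (ZMod.ringEquivCongr (by simp [b, hm₀])).toAddEquiv
    let g₄ : ((i : Fin k) → ZMod (a i)) ≃+ ((i : Fin k) → ZMod (b i.castSucc)) :=
      AddEquiv.piCongrRight fun i => (ZMod.ringEquivCongr (by simp [b])).toAddEquiv
    exact ⟨g₁.trans ((AddEquiv.prodCongr g₃ (f.trans g₄)).trans g₂.symm)⟩

theorem exists_hasInvariantFactorCount (K : Type*) [AddCommGroup K] [Finite K] :
    ∃ k, HasInvariantFactorCount K k := by
  classical
  obtain ⟨ι, _, p, hp, e, ⟨f⟩⟩ := AddCommGroup.equiv_directSum_zmod_of_finite K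
  obtain ⟨k, a, h1, h2, -, ⟨g⟩⟩ := exists_invariantFactors_pi
    (fun i : {i // e i ≠ 0} => p i) (fun i => e i) (fun i => hp i) (fun i => i.2)
  -- The structure theorem may return trivial factors with exponent 0; they are split off.
  let g₁ : ((i : ι) → ZMod (p i ^ e i)) ≃+
      ((i : {i // e i ≠ 0}) → ZMod (p i ^ e i)) × ((i : {i // ¬ e i ≠ 0}) → ZMod (p i ^ e i)) :=
    { Equiv.piEquivPiSubtypeProd (fun i => e i ≠ 0) fun i => ZMod (p i ^ e i) with
      map_add' := fun _ _ => rfl }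
  have : Unique ((i : {i // ¬ e i ≠ 0}) → ZMod (p i ^ e i)) :=
    { default := 0
      uniq := fun x => funext fun i => by
        have h : p i ^ e i = 1 := by rw [not_not.1 i.2, pow_zero]
        have : Subsingleton (ZMod (p i ^ e i)) := ZMod.subsingleton_iff.2 h
        exact Subsingleton.elim _ _ }
  exact ⟨k, a, h1, h2, ⟨f.trans ((DirectSum.addEquivProd _).trans
    (g₁.trans (AddEquiv.prodUnique.trans g)))⟩⟩

namespace SimpleGraph

/-! ### Rooted trees -/

/-- `p` is the parent map of a rooted tree structure on `G` with root `ρ`: the edges of `G` are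
the pairs consisting of a vertex other than `ρ` and its parent, and `depth` decreases from a
vertex to its parent. -/
structure IsParentMap {V : Type*} (G : SimpleGraph V) (ρ : V) (p : V → V) (depth : V → ℕ) :
    Prop where
  adj_iff : ∀ u v, G.Adj u v ↔ (u ≠ ρ ∧ p u = v) ∨ (v ≠ ρ ∧ p v = u)
  depth_lt : ∀ v, v ≠ ρ → depth (p v) < depth v

/-- The parent is the unique neighbour closer to `ρ`: two such neighbours would give two paths from
the vertex to `ρ`. Adjacent vertices of a tree never have equal distance to `ρ`, so every edge is a
parent edge. -/
theorem IsTree.exists_isParentMap {V : Type*} {G : SimpleGraph V} (hG : G.IsTree) (ρ : V) :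
    ∃ p depth, G.IsParentMap ρ p depth := by
  classical
  have hex : ∀ v, ∃ u, v ≠ ρ → G.Adj v u ∧ G.dist ρ u < G.dist ρ v ∧
      ∀ u', G.Adj v u' → G.dist ρ u' < G.dist ρ v → u' = u := by
    intro v
    by_cases hv : v = ρ
    · exact ⟨v, fun h => absurd hv h⟩
    obtain ⟨q, hq, hlen⟩ := hG.connected.exists_path_of_dist v ρ
    have hnil : ¬ q.Nil := fun h => hv h.eq
    have hlt : ∀ u, G.Adj v u → G.dist ρ u < G.dist ρ v → q.snd = u := by
      intro u hu hlt
      obtain ⟨q', hq', hlen'⟩ := hG.connected.exists_path_of_dist u ρ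
      have hns : v ∉ q'.support := by
        intro hmem
        have h1 := SimpleGraph.dist_le (q'.dropUntil v hmem)
        have h2 := q'.length_dropUntil_le_length hmem
        rw [dist_comm] at h1
        rw [dist_comm] at hlen'
        omega
      have hp : (Walk.cons hu q').IsPath := by
        rw [Walk.cons_isPath_iff]; exact ⟨hq', hns⟩
      have := (hG.isAcyclic.subsingleton_path v ρ).elim ⟨q, hq⟩ ⟨_, hp⟩
      have h3 : q = Walk.cons hu q' := congrArg Subtype.val this
      rw [h3]
      simp
    refine ⟨q.snd, fun _ => ⟨q.adj_snd hnil, ?_, fun u hu h => (hlt u hu h).symm⟩⟩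
    have h1 := SimpleGraph.dist_le q.tail
    have h2 := q.length_tail_add_one hnil
    rw [dist_comm] at h1 hlen
    have := G.dist_comm (u := ρ) (v := v)
    omega
  choose p hp using hex
  refine ⟨p, fun v => G.dist ρ v, fun u v => ⟨fun h => ?_, ?_⟩, fun v hv => (hp v hv).2.1⟩
  · rcases lt_trichotomy (G.dist ρ u) (G.dist ρ v) with hlt | heq | hlt
    · have hv : v ≠ ρ := by rintro rfl; simp at hlt
      exact Or.inr ⟨hv, ((hp v hv).2.2 u h.symm hlt).symm⟩
    · exact absurd heq (hG.dist_ne_of_adj ρ h)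
    · have hu : u ≠ ρ := by rintro rfl; simp at hlt
      exact Or.inl ⟨hu, ((hp u hu).2.2 v h hlt).symm⟩
  · rintro (⟨hu, rfl⟩ | ⟨hv, rfl⟩)
    · exact (hp u hu).1
    · exact (hp v hv).1.symm

/-- The children of `v` with respect to a parent map. -/
def childFinset {V : Type*} [Fintype V] [DecidableEq V] (ρ : V) (p : V → V) (v : V) : Finset V :=
  {w | w ≠ ρ ∧ p w = v}

/-- The children of `v` which do not lie in `Q`. -/
def freeChildFinset {V : Type*} [Fintype V] [DecidableEq V] (ρ : V) (p : V → V) (Q : Finset V)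
    (v : V) : Finset V :=
  {w | w ≠ ρ ∧ p w = v ∧ w ∉ Q}

/-- The children of `v` which lie in `Q`. -/
def branchChildFinset {V : Type*} [Fintype V] [DecidableEq V] (ρ : V) (p : V → V) (Q : Finset V)
    (v : V) : Finset V :=
  {w | w ≠ ρ ∧ p w = v ∧ w ∈ Q}

/-- `Q` is the set of branch vertices of a rooted tree: the vertices other than the root with at
least two children outside `Q`. -/
def IsBranchSet {V : Type*} [Fintype V] [DecidableEq V] (ρ : V) (p : V → V) (Q : Finset V) :
    Prop :=
  ∀ v, v ∈ Q ↔ v ≠ ρ ∧ 2 ≤ (freeChildFinset ρ p Q v).card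

section

variable {V : Type*} [Fintype V] [DecidableEq V] {ρ : V} {p : V → V} {Q : Finset V} {v w : V}

@[simp] theorem mem_childFinset : w ∈ childFinset ρ p v ↔ w ≠ ρ ∧ p w = v := by
  simp [childFinset]

@[simp] theorem mem_freeChildFinset : w ∈ freeChildFinset ρ p Q v ↔ w ≠ ρ ∧ p w = v ∧ w ∉ Q := by
  simp [freeChildFinset]

@[simp] theorem mem_branchChildFinset :
    w ∈ branchChildFinset ρ p Q v ↔ w ≠ ρ ∧ p w = v ∧ w ∈ Q := by
  simp [branchChildFinset]

theorem sum_childFinset {M : Type*} [AddCommMonoid M] (f : V → M) :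
    ∑ w ∈ childFinset ρ p v, f w =
      ∑ w ∈ branchChildFinset ρ p Q v, f w + ∑ w ∈ freeChildFinset ρ p Q v, f w := by
  rw [← Finset.sum_union]
  · congr 1
    ext w
    simp only [mem_childFinset, Finset.mem_union, mem_branchChildFinset, mem_freeChildFinset]
    tauto
  · rw [Finset.disjoint_left]
    intro w h1 h2
    simp only [mem_branchChildFinset, mem_freeChildFinset] at h1 h2
    exact h2.2.2 h1.2.2

namespace IsParentMap

variable {G : SimpleGraph V} {depth : V → ℕ}

omit [Fintype V] [DecidableEq V] in
theorem top_down (h : G.IsParentMap ρ p depth) {P : V → Prop}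
    (hP : ∀ v, (v ≠ ρ → P (p v)) → P v) (v : V) : P v := by
  induction hn : depth v using Nat.strong_induction_on generalizing v with
  | _ n ih =>
    refine hP v fun hv => ih _ ?_ _ rfl
    rw [← hn]
    exact h.depth_lt v hv

omit [DecidableEq V] in
theorem bottom_up_wf (h : G.IsParentMap ρ p depth) :
    WellFounded fun w v => w ≠ ρ ∧ p w = v := by
  refine Subrelation.wf (r := InvImage (· < ·) fun v => Finset.univ.sup depth - depth v) ?_
    (InvImage.wf _ wellFounded_lt)
  rintro w v ⟨hw, rfl⟩
  have h1 := h.depth_lt w hw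
  have h2 : depth w ≤ Finset.univ.sup depth := Finset.le_sup (Finset.mem_univ w)
  simp only [InvImage]
  omega

omit [DecidableEq V] in
theorem bottom_up (h : G.IsParentMap ρ p depth) {P : V → Prop}
    (hP : ∀ v, (∀ w, w ≠ ρ → p w = v → P w) → P v) (v : V) : P v :=
  h.bottom_up_wf.induction v fun v ih => hP v fun w h1 h2 => ih w ⟨h1, h2⟩

omit [Fintype V] [DecidableEq V] in
theorem parent_adj (h : G.IsParentMap ρ p depth) (hv : v ≠ ρ) : G.Adj v (p v) :=
  (h.adj_iff _ _).2 (Or.inl ⟨hv, rfl⟩)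

omit [Fintype V] [DecidableEq V] in
theorem parent_parent_ne (h : G.IsParentMap ρ p depth) (hv : v ≠ ρ) (hpv : p v ≠ ρ) :
    p (p v) ≠ v := by
  intro h1
  have h2 := h.depth_lt v hv
  have h3 := h.depth_lt (p v) hpv
  rw [h1] at h3
  omega

theorem neighborFinset_eq (h : G.IsParentMap ρ p depth) [DecidableRel G.Adj] (v : V) :
    G.neighborFinset v = (if v = ρ then ∅ else {p v}) ∪ childFinset ρ p v := by
  ext u
  rw [mem_neighborFinset, h.adj_iff, Finset.mem_union, mem_childFinset]
  split_ifs with hv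
  · simp [hv]
  · simp [hv, eq_comm]

theorem disjoint_childFinset (h : G.IsParentMap ρ p depth) (v : V) :
    Disjoint (if v = ρ then (∅ : Finset V) else {p v}) (childFinset ρ p v) := by
  split_ifs with hv
  · simp
  · simp only [Finset.disjoint_singleton_left, mem_childFinset, not_and]
    exact fun hpv => h.parent_parent_ne hv hpv

theorem sum_neighborFinset (h : G.IsParentMap ρ p depth) [DecidableRel G.Adj] {M : Type*}
    [AddCommMonoid M] (f : V → M) (v : V) :
    ∑ u ∈ G.neighborFinset v, f u =
      (if v = ρ then 0 else f (p v)) + ∑ w ∈ childFinset ρ p v, f w := by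
  rw [h.neighborFinset_eq, Finset.sum_union (h.disjoint_childFinset v)]
  split_ifs <;> simp

theorem degree_eq (h : G.IsParentMap ρ p depth) [DecidableRel G.Adj] (v : V) :
    G.degree v = (if v = ρ then 0 else 1) + (childFinset ρ p v).card := by
  rw [← card_neighborFinset_eq_degree, h.neighborFinset_eq,
    Finset.card_union_of_disjoint (h.disjoint_childFinset v)]
  split_ifs <;> simp

/-- The condition on `Q` refers to `Q` itself, but only at children, so well-founded recursion from
the bottom of the tree solves it. -/
theorem exists_isBranchSet (h : G.IsParentMap ρ p depth) : ∃ Q, IsBranchSet ρ p Q := by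
  classical
  let P : V → Prop := h.bottom_up_wf.fix fun v ih =>
    v ≠ ρ ∧ 2 ≤ (Finset.univ.filter fun w => ∃ h : w ≠ ρ ∧ p w = v, ¬ ih w h).card
  have hP : ∀ v, P v ↔ v ≠ ρ ∧
      2 ≤ (Finset.univ.filter fun w => ∃ _ : w ≠ ρ ∧ p w = v, ¬ P w).card := by
    intro v
    exact (h.bottom_up_wf.fix_eq _ v).to_iff
  refine ⟨Finset.univ.filter P, fun v => ?_⟩
  rw [Finset.mem_filter, hP]
  simp only [Finset.mem_univ, true_and]
  have : (Finset.univ.filter fun w => ∃ _ : w ≠ ρ ∧ p w = v, ¬ P w) =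
      freeChildFinset ρ p (Finset.univ.filter P) v := by
    ext w
    simp [and_assoc]
  rw [this]

/-- The root is excluded from `Q` by definition; choosing a leaf as root makes the bound hold there
as well. -/
theorem card_freeChildFinset_le_one (h : G.IsParentMap ρ p depth) [DecidableRel G.Adj]
    (hQ : IsBranchSet ρ p Q) (hρ : G.degree ρ = 1) (hv : v ∉ Q) :
    (freeChildFinset ρ p Q v).card ≤ 1 := by
  by_cases hvρ : v = ρ
  · subst hvρ
    have h1 := h.degree_eq v
    rw [hρ, if_pos rfl, zero_add] at h1
    rw [h1]
    refine Finset.card_le_card fun w hw => ?_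
    simp only [mem_freeChildFinset, mem_childFinset] at hw ⊢
    exact ⟨hw.1, hw.2.1⟩
  · by_contra hcon
    exact hv ((hQ v).2 ⟨hvρ, by omega⟩)

end IsParentMap

end

end SimpleGraph

namespace SimpleGraph

/-! ### The 2-matching number of a rooted tree -/

/-- The number of edges that a maximum 2-matching of a rooted tree with branch set `Q` leaves
out. -/
def branchExcess {V : Type*} [Fintype V] [DecidableEq V] (ρ : V) (p : V → V) (Q : Finset V) : ℕ :=
  ∑ v ∈ Q, ((freeChildFinset ρ p Q v).card - 1)

namespace IsParentMap

variable {V : Type*} [Fintype V] [DecidableEq V] {ρ : V} {p : V → V} {Q : Finset V} {v w : V}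
  {G : SimpleGraph V} {depth : V → ℕ}

omit [Fintype V] [DecidableEq V] in
theorem injOn_parentEdge (h : G.IsParentMap ρ p depth) :
    Set.InjOn (fun v => s(v, p v)) {v | v ≠ ρ} := by
  intro u hu w hw huw
  simp only [Sym2.eq_iff] at huw
  rcases huw with ⟨h1, -⟩ | ⟨h1, h2⟩
  · exact h1
  · subst h1
    exact absurd h2 (h.parent_parent_ne hw hu)

omit [Fintype V] [DecidableEq V] in
theorem edgeSet_eq (h : G.IsParentMap ρ p depth) :
    G.edgeSet = (fun v => s(v, p v)) '' {v | v ≠ ρ} := by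
  ext e
  induction e with
  | _ u w =>
  rw [mem_edgeSet, h.adj_iff]
  constructor
  · rintro (⟨hu, rfl⟩ | ⟨hw, rfl⟩)
    · exact ⟨u, hu, rfl⟩
    · exact ⟨w, hw, Sym2.eq_swap⟩
  · rintro ⟨v, hv, he⟩
    simp only [Sym2.eq_iff] at he
    rcases he with ⟨rfl, rfl⟩ | ⟨rfl, rfl⟩
    · exact Or.inl ⟨hv, rfl⟩
    · exact Or.inr ⟨hv, rfl⟩

theorem ncard_edgeSet (h : G.IsParentMap ρ p depth) :
    G.edgeSet.ncard = (Finset.univ.erase ρ).card := by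
  rw [h.edgeSet_eq, h.injOn_parentEdge.ncard_image, ← Set.ncard_coe_finset]
  congr 1
  ext v
  simp

/-- Edges are encoded by their lower ends. For `v ∈ Q` the set `F v` encodes `f v + 1` edges at `v`,
of which at least `f v - 1` are missing from `M`. These sets are disjoint because free children lie
outside `Q`. -/
theorem ncard_add_branchExcess_le (h : G.IsParentMap ρ p depth) (hQ : IsBranchSet ρ p Q)
    {M : Set (Sym2 V)} (hM : G.IsTwoMatching M) :
    M.ncard + branchExcess ρ p Q ≤ G.edgeSet.ncard := by
  classical
  let W : Finset V := {v | v ≠ ρ ∧ s(v, p v) ∈ M}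
  have hMW : M = (fun v => s(v, p v)) '' (W : Set V) := by
    ext e
    constructor
    · intro he
      have he' := hM.1 he
      rw [h.edgeSet_eq] at he'
      obtain ⟨v, hv, rfl⟩ := he'
      exact ⟨v, by simpa [W] using ⟨hv, he⟩, rfl⟩
    · rintro ⟨v, hv, rfl⟩
      simp only [W, Finset.coe_filter, Finset.mem_univ, true_and, Set.mem_ofPred_eq] at hv
      exact hv.2
  have hinj : Set.InjOn (fun v => s(v, p v)) (W : Set V) :=
    h.injOn_parentEdge.mono fun v hv => by
      simp only [W, Finset.coe_filter, Finset.mem_univ, true_and, Set.mem_ofPred_eq] at hv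
      exact hv.1
  have hMcard : M.ncard = W.card := by
    rw [hMW, hinj.ncard_image, Set.ncard_coe_finset]
  let F : V → Finset V := fun v => insert v (freeChildFinset ρ p Q v)
  have hFcard : ∀ v ∈ Q, (F v).card = (freeChildFinset ρ p Q v).card + 1 := fun v hv =>
    Finset.card_insert_of_notMem fun h' => (mem_freeChildFinset.1 h').2.2 hv
  have hWF : ∀ v, (W ∩ F v).card ≤ 2 := by
    intro v
    refine le_trans ?_ (hM.2 v)
    have h1 : (fun v => s(v, p v)) '' ((W ∩ F v : Finset V) : Set V) ⊆ {e ∈ M | v ∈ e} := by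
      rintro _ ⟨w, hw, rfl⟩
      simp only [W, F, Finset.coe_inter, Finset.coe_filter, Finset.mem_univ, true_and,
        Set.mem_inter_iff, Set.mem_ofPred_eq, Finset.mem_coe, Finset.mem_insert,
        mem_freeChildFinset] at hw
      refine ⟨hw.1.2, ?_⟩
      rcases hw.2 with rfl | hw
      · simp
      · simp [hw.2.1]
    calc (W ∩ F v).card = ((fun v => s(v, p v)) '' ((W ∩ F v : Finset V) : Set V)).ncard := by
          rw [(hinj.mono (by simp)).ncard_image, Set.ncard_coe_finset]
      _ ≤ _ := Set.ncard_le_ncard h1 (Set.toFinite _)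
  have hFdisj : (Q : Set V).PairwiseDisjoint fun v => F v \ W := by
    intro u hu v hv huv
    refine Disjoint.mono Finset.sdiff_subset Finset.sdiff_subset ?_
    rw [Finset.disjoint_left]
    intro w hwu hwv
    simp only [F, Finset.mem_insert, mem_freeChildFinset] at hwu hwv
    rcases hwu with rfl | ⟨-, hw1, hw2⟩
    · rcases hwv with rfl | ⟨-, -, hw⟩
      · exact huv rfl
      · exact hw hu
    · rcases hwv with rfl | ⟨-, hw3, -⟩
      · exact hw2 hv
      · exact huv (hw1.symm.trans hw3)
  have hsub : Q.biUnion (fun v => F v \ W) ⊆ Finset.univ.erase ρ \ W := by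
    intro w hw
    simp only [Finset.mem_biUnion, Finset.mem_sdiff, F, Finset.mem_insert,
      mem_freeChildFinset] at hw
    obtain ⟨v, hv, hw, hwW⟩ := hw
    simp only [Finset.mem_sdiff, Finset.mem_erase, Finset.mem_univ, and_true]
    refine ⟨?_, hwW⟩
    rcases hw with rfl | hw
    · exact ((hQ w).1 hv).1
    · exact hw.1
  have h1 := Finset.card_le_card hsub
  rw [Finset.card_biUnion hFdisj, Finset.card_sdiff_of_subset] at h1
  · have hWle : W.card ≤ (Finset.univ.erase ρ).card := Finset.card_le_card fun v hv => by
      simp only [W, Finset.mem_filter, Finset.mem_univ, true_and] at hv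
      simpa using hv.1
    have h2 : branchExcess ρ p Q ≤ ∑ v ∈ Q, (F v \ W).card := by
      refine Finset.sum_le_sum fun v hv => ?_
      have h3 := Finset.card_sdiff_add_card_inter (F v) W
      have h4 := hWF v
      rw [Finset.inter_comm] at h4
      have h5 := hFcard v hv
      omega
    rw [hMcard, h.ncard_edgeSet]
    omega
  · intro v hv
    simp only [W, Finset.mem_filter, Finset.mem_univ, true_and] at hv
    simpa using hv.1

/-- Omit the parent edge of every `v ∈ Q` and all but two of its free child edges, `1 + (f v - 2)`
edges in total. A vertex outside `Q` keeps at most its parent edge and one free child edge. -/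
theorem exists_isTwoMatching (h : G.IsParentMap ρ p depth) (hQ : IsBranchSet ρ p Q)
    (hfree : ∀ v, v ∉ Q → (freeChildFinset ρ p Q v).card ≤ 1) :
    ∃ M, G.IsTwoMatching M ∧ G.edgeSet.ncard ≤ M.ncard + branchExcess ρ p Q := by
  classical
  have hc : ∀ v, ∃ c, v ∈ Q → c ⊆ freeChildFinset ρ p Q v ∧ c.card = 2 := by
    intro v
    by_cases hv : v ∈ Q
    · obtain ⟨c, hc⟩ := Finset.exists_subset_card_eq ((hQ v).1 hv).2
      exact ⟨c, fun _ => hc⟩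
    · exact ⟨∅, fun h => absurd h hv⟩
  choose c hc using hc
  let R : Finset V := Q ∪ Q.biUnion fun v => freeChildFinset ρ p Q v \ c v
  have hR : R.card ≤ branchExcess ρ p Q := by
    refine (Finset.card_union_le _ _).trans ?_
    have h1 : (Q.biUnion fun v => freeChildFinset ρ p Q v \ c v).card ≤
        ∑ v ∈ Q, ((freeChildFinset ρ p Q v).card - 2) := by
      refine Finset.card_biUnion_le.trans (Finset.sum_le_sum fun v hv => ?_)
      rw [Finset.card_sdiff_of_subset (hc v hv).1, (hc v hv).2]
    have h2 : branchExcess ρ p Q =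
        ∑ v ∈ Q, (1 + ((freeChildFinset ρ p Q v).card - 2)) := by
      refine Finset.sum_congr rfl fun v hv => ?_
      have := ((hQ v).1 hv).2
      omega
    rw [h2, Finset.sum_add_distrib]
    simpa using h1
  let W : Finset V := Finset.univ.erase ρ \ R
  have hinj : Set.InjOn (fun v => s(v, p v)) (W : Set V) :=
    h.injOn_parentEdge.mono fun v hv => by
      simp only [W, Finset.coe_sdiff, Set.mem_sdiff, Finset.mem_coe, Finset.mem_erase] at hv
      exact hv.1.1
  refine ⟨(fun v => s(v, p v)) '' (W : Set V), ⟨?_, fun v => ?_⟩, ?_⟩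
  · rw [h.edgeSet_eq]
    refine Set.image_mono fun v hv => ?_
    simp only [W, Finset.coe_sdiff, Set.mem_sdiff, Finset.mem_coe, Finset.mem_erase] at hv
    exact hv.1.1
  · let X : Finset V := {w ∈ W | w = v ∨ p w = v}
    have h1 : {e ∈ (fun v => s(v, p v)) '' (W : Set V) | v ∈ e} ⊆
        (fun v => s(v, p v)) '' (X : Set V) := by
      rintro _ ⟨⟨w, hw, rfl⟩, hv⟩
      refine ⟨w, ?_, rfl⟩
      simp only [Sym2.mem_iff] at hv
      simp only [X, Finset.coe_filter, Set.mem_ofPred_eq]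
      exact ⟨hw, hv.imp Eq.symm Eq.symm⟩
    refine (Set.ncard_le_ncard h1 (Set.toFinite _)).trans
      ((Set.ncard_image_le (Set.toFinite _)).trans ?_)
    rw [Set.ncard_coe_finset]
    by_cases hv : v ∈ Q
    · rw [← (hc v hv).2]
      refine Finset.card_le_card fun w hw => ?_
      simp only [X, W, R, Finset.mem_filter, Finset.mem_sdiff, Finset.mem_erase, Finset.mem_univ,
        and_true, Finset.mem_union, Finset.mem_biUnion, not_or, not_exists, not_and, not_not,
        mem_freeChildFinset] at hw
      obtain ⟨⟨hw1, hw2, hw3⟩, rfl | hw4⟩ := hw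
      · exact absurd hv hw2
      · exact hw3 v hv ⟨hw1, hw4, hw2⟩
    · have hX : X ⊆ insert v (freeChildFinset ρ p Q v) := by
        intro w hw
        simp only [X, W, R, Finset.mem_filter, Finset.mem_sdiff, Finset.mem_erase, Finset.mem_univ,
          and_true, Finset.mem_union, not_or] at hw
        rw [Finset.mem_insert, mem_freeChildFinset]
        tauto
      exact (Finset.card_le_card hX).trans ((Finset.card_insert_le _ _).trans
        (Nat.succ_le_succ (hfree v hv)))
  · rw [hinj.ncard_image, Set.ncard_coe_finset, h.ncard_edgeSet]
    have := Finset.le_card_sdiff R (Finset.univ.erase ρ)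
    simp only [W]
    omega

theorem twoMatchingNumber_add_branchExcess (h : G.IsParentMap ρ p depth)
    (hQ : IsBranchSet ρ p Q) (hfree : ∀ v, v ∉ Q → (freeChildFinset ρ p Q v).card ≤ 1) :
    G.twoMatchingNumber + branchExcess ρ p Q = G.edgeSet.ncard := by
  obtain ⟨⟨M, hM, hMn⟩, hub⟩ := G.isGreatest_twoMatchingNumber
  apply le_antisymm
  · rw [← hMn]
    exact h.ncard_add_branchExcess_le hQ hM
  · obtain ⟨M', hM', hle⟩ := h.exists_isTwoMatching hQ hfree
    have := hub ⟨M', hM', rfl⟩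
    omega

end IsParentMap

end SimpleGraph

namespace SimpleGraph

/-! ### Kernel vectors of the generalized Laplacian of a rooted tree -/

/-- The vector `y` with entries in `R` lies in the kernel of `diag(d) - A(G)`. -/
def IsKernelVector {V : Type*} [Fintype V] (G : SimpleGraph V) [DecidableRel G.Adj]
    (d : V → ℤ) {R : Type*} [Ring R] (y : V → R) : Prop :=
  ∀ v, (d v : R) * y v = ∑ u ∈ G.neighborFinset v, y u

namespace IsParentMap

variable {V : Type*} [Fintype V] [DecidableEq V] {ρ : V} {p : V → V} {Q : Finset V} {v w : V}
  {G : SimpleGraph V} {depth : V → ℕ} [DecidableRel G.Adj]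

theorem kernelVector_eq (h : G.IsParentMap ρ p depth) (Q : Finset V) {d : V → ℤ} {R : Type*}
    [Ring R] {y : V → R} (hy : G.IsKernelVector d y) (v : V) :
    (d v : R) * y v = (if v = ρ then 0 else y (p v)) +
      (∑ w ∈ branchChildFinset ρ p Q v, y w + ∑ w ∈ freeChildFinset ρ p Q v, y w) := by
  rw [hy v, h.sum_neighborFinset, sum_childFinset]

/-- A kernel vector on a rooted tree is determined by its values at the root and at the lower ends
of all but one of the paths hanging from each branch vertex. -/
theorem exists_determining_finset (h : G.IsParentMap ρ p depth) (hQ : IsBranchSet ρ p Q)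
    (hfree : ∀ v, v ∉ Q → (freeChildFinset ρ p Q v).card ≤ 1) :
    ∃ S : Finset V, S.card ≤ branchExcess ρ p Q + 1 ∧ ∀ (R : Type) [CommRing R] (d : V → ℤ)
      (y : V → R), G.IsKernelVector d y → (∀ v ∈ S, y v = 0) → ∀ v, y v = 0 := by
  classical
  -- `b v` is the lower end of a path that descends from `v` through free children.
  have hb : ∃ b : V → V, ∀ v, (freeChildFinset ρ p Q v = ∅ ∧ b v = v) ∨
      ∃ w ∈ freeChildFinset ρ p Q v, b v = b w := by
    refine ⟨h.bottom_up_wf.fix fun v ih =>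
      if hne : (freeChildFinset ρ p Q v).Nonempty then
        ih hne.choose
          ⟨(mem_freeChildFinset.1 hne.choose_spec).1, (mem_freeChildFinset.1 hne.choose_spec).2.1⟩
      else v, fun v => ?_⟩
    by_cases hne : (freeChildFinset ρ p Q v).Nonempty
    · right
      refine ⟨hne.choose, hne.choose_spec, ?_⟩
      rw [WellFounded.fix_eq, dif_pos hne]
    · left
      refine ⟨Finset.not_nonempty_iff_eq_empty.1 hne, ?_⟩
      rw [WellFounded.fix_eq, dif_neg hne]
  obtain ⟨b, hb⟩ := hb
  -- `g v` is the set of all free children of `v` but one.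
  have hg : ∀ v, ∃ g, v ∈ Q → g ⊆ freeChildFinset ρ p Q v ∧
      g.card = (freeChildFinset ρ p Q v).card - 1 := by
    intro v
    obtain ⟨g, hg⟩ := Finset.exists_subset_card_eq (Nat.sub_le (freeChildFinset ρ p Q v).card 1)
    exact ⟨g, fun _ => hg⟩
  choose g hg using hg
  refine ⟨insert ρ (Q.biUnion fun v => (g v).image b), ?_, ?_⟩
  · refine (Finset.card_insert_le _ _).trans (Nat.succ_le_succ ?_)
    refine Finset.card_biUnion_le.trans (Finset.sum_le_sum fun v hv => ?_)
    exact Finset.card_image_le.trans (hg v hv).2.le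
  intro R _ d y hy hS
  have hroot : y ρ = 0 := hS ρ (Finset.mem_insert_self _ _)
  have hbot : ∀ v ∈ Q, ∀ w ∈ g v, y (b w) = 0 := fun v hv w hw =>
    hS _ (Finset.mem_insert_of_mem (Finset.mem_biUnion.2 ⟨v, hv, Finset.mem_image_of_mem b hw⟩))
  -- Zeros travel upwards: along a path outside `Q` the branch children contribute nothing, so a
  -- zero at the bottom forces zeros up to the parent of the top. A branch vertex has some path in
  -- `g v`, hence itself vanishes.
  have hup : ∀ v, (v ∈ Q → y v = 0) ∧
      (v ∉ Q → y (b v) = 0 → y v = 0 ∧ (v ≠ ρ → y (p v) = 0)) := by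
    refine h.bottom_up fun v ih => ⟨fun hv => ?_, fun hv hbv => ?_⟩
    · have hne : (g v).Nonempty := by
        rw [← Finset.card_pos, (hg v hv).2]
        have := ((hQ v).1 hv).2
        omega
      obtain ⟨w, hw⟩ := hne
      obtain ⟨hw1, hw2, hw3⟩ := mem_freeChildFinset.1 ((hg v hv).1 hw)
      have := ((ih w hw1 hw2).2 hw3 (hbot v hv w hw)).2 hw1
      rwa [hw2] at this
    · have hrel := h.kernelVector_eq Q hy v
      have hzero : ∑ w ∈ branchChildFinset ρ p Q v, y w = 0 := Finset.sum_eq_zero fun w hw => by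
        obtain ⟨hw1, hw2, hw3⟩ := mem_branchChildFinset.1 hw
        exact (ih w hw1 hw2).1 hw3
      rw [hzero, zero_add] at hrel
      rcases hb v with ⟨hv1, hv2⟩ | ⟨w, hw, hbw⟩
      · rw [hv2] at hbv
        refine ⟨hbv, fun hvρ => ?_⟩
        rw [hv1, hbv, if_neg hvρ] at hrel
        simpa using hrel.symm
      · have hfv : freeChildFinset ρ p Q v = {w} :=
          Finset.eq_singleton_iff_unique_mem.2
            ⟨hw, fun x hx => Finset.card_le_one.1 (hfree v hv) x hx w hw⟩
        obtain ⟨hw1, hw2, hw3⟩ := mem_freeChildFinset.1 hw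
        rw [hbw] at hbv
        obtain ⟨hyw, hypw⟩ := (ih w hw1 hw2).2 hw3 hbv
        have hyv := hypw hw1
        rw [hw2] at hyv
        refine ⟨hyv, fun hvρ => ?_⟩
        rw [hfv, hyv, if_neg hvρ, Finset.sum_singleton, hyw] at hrel
        simpa using hrel.symm
  refine fun v => (h.top_down (P := fun v => y v = 0 ∧ (v ≠ ρ → y (p v) = 0))
    (fun v ih => ⟨?_, fun hv => (ih hv).1⟩) v).1
  by_cases hvQ : v ∈ Q
  · exact (hup v).1 hvQ
  by_cases hvρ : v = ρ
  · rw [hvρ, hroot]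
  -- Zeros travel downwards: the relation at `u` kills the one free child left over once all other
  -- neighbours vanish.
  have key : ∀ u, y u = 0 → (u ≠ ρ → y (p u) = 0) → v ∈ freeChildFinset ρ p Q u →
      (∀ w ∈ freeChildFinset ρ p Q u, w ≠ v → y w = 0) → y v = 0 := by
    intro u hu hpu hvu hw
    have hrel := h.kernelVector_eq Q hy u
    have hzero : ∑ w ∈ branchChildFinset ρ p Q u, y w = 0 := Finset.sum_eq_zero fun w hw =>
      (hup w).1 (mem_branchChildFinset.1 hw).2.2
    have hpar : (if u = ρ then 0 else y (p u)) = 0 := by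
      split_ifs with hur
      · rfl
      · exact hpu hur
    rw [hzero, hu, hpar, Finset.sum_eq_single_of_mem v hvu hw] at hrel
    simpa using hrel.symm
  have hmem : v ∈ freeChildFinset ρ p Q (p v) := mem_freeChildFinset.2 ⟨hvρ, rfl, hvQ⟩
  obtain ⟨h1, h2⟩ := ih hvρ
  by_cases hpv : p v ∈ Q
  · by_cases hvg : v ∈ g (p v)
    · exact ((hup v).2 hvQ (hbot _ hpv v hvg)).1
    · have hge : g (p v) = (freeChildFinset ρ p Q (p v)).erase v := by
        refine Finset.eq_of_subset_of_card_le (fun w hw => ?_) ?_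
        · exact Finset.mem_erase.2 ⟨fun hwv => hvg (hwv ▸ hw), (hg _ hpv).1 hw⟩
        · rw [Finset.card_erase_of_mem hmem, (hg _ hpv).2]
      refine key _ h1 h2 hmem fun w hw hwv => ?_
      have hwg : w ∈ g (p v) := by rw [hge]; exact Finset.mem_erase.2 ⟨hwv, hw⟩
      exact ((hup w).2 (mem_freeChildFinset.1 hw).2.2 (hbot _ hpv w hwg)).1
  · refine key _ h1 h2 hmem fun w hw hwv => ?_
    exact absurd (Finset.card_le_one.1 (hfree _ hpv) w hw v hmem) hwv

end IsParentMap

end SimpleGraph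

/-! ### Homomorphisms from a finitely generated abelian group of rank one -/

/-- A group with a homomorphism onto `ℤ` is the product of `ℤ` and the kernel. -/
def AddMonoidHom.equivIntProdKer {M : Type*} [AddCommGroup M] (ψ : M →+ ℤ) (m₀ : M)
    (hm₀ : ψ m₀ = 1) : M ≃+ ℤ × ψ.ker where
  toFun x := (ψ x, ⟨x - ψ x • m₀, by simp [AddMonoidHom.mem_ker, hm₀]⟩)
  invFun x := x.1 • m₀ + x.2
  left_inv x := by simp
  right_inv x := by
    have := AddMonoidHom.mem_ker.1 x.2.2
    ext <;> simp [hm₀, this]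
  map_add' x y := by
    ext
    · simp
    · simp [add_smul]
      abel

/-- A prime dividing the first invariant factor divides them all, so every cyclic factor maps onto
`ZMod q`. If `k = 0`, any prime works. -/
theorem exists_prime_injective_hom {M : Type*} [AddCommGroup M] {k : ℕ} {a : Fin k → ℕ}
    (ha : ∀ i, 1 < a i) (hdvd : ∀ i j, i ≤ j → a i ∣ a j)
    (e : M ≃+ ℤ × ((i : Fin k) → ZMod (a i))) :
    ∃ q : ℕ, q.Prime ∧ ∃ Φ : ZMod q × (Fin k → ZMod q) → (M →+ ZMod q),
      Function.Injective Φ := by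
  classical
  obtain ⟨q, hq, hqa⟩ : ∃ q : ℕ, q.Prime ∧ ∀ i, q ∣ a i := by
    rcases k with _ | k
    · exact ⟨2, Nat.prime_two, fun i => i.elim0⟩
    · obtain ⟨q, hq, hqa⟩ := Nat.exists_prime_and_dvd (ha 0).ne'
      exact ⟨q, hq, fun i => hqa.trans (hdvd 0 i (Fin.zero_le i))⟩
  refine ⟨q, hq, fun c =>
    { toFun := fun x => ((e x).1 : ZMod q) * c.1 + ∑ i, ZMod.castHom (hqa i) _ ((e x).2 i) * c.2 i
      map_zero' := by simp
      map_add' := fun x y => by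
        simp only [map_add, Prod.fst_add, Prod.snd_add, Pi.add_apply, Int.cast_add, add_mul,
          Finset.sum_add_distrib]
        abel }, ?_⟩
  rintro ⟨c, c'⟩ ⟨b, b'⟩ hcb
  have key := fun z => DFunLike.congr_fun hcb (e.symm z)
  simp only [AddMonoidHom.coe_mk, ZeroHom.coe_mk, AddEquiv.apply_symm_apply] at key
  refine Prod.ext ?_ (funext fun i => ?_)
  · simpa using key (1, 0)
  · have := key (0, Pi.single i 1)
    have hs : ∀ f : Fin k → ZMod q,
        ∑ j, ZMod.castHom (hqa j) (ZMod q) ((Pi.single i 1 : (i : Fin k) → ZMod (a i)) j) * f j =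
          f i := by
      intro f
      rw [Finset.sum_eq_single i]
      · rw [Pi.single_eq_same, map_one, one_mul]
      · intro j _ hj
        rw [Pi.single_eq_of_ne hj, map_zero, zero_mul]
      · simp
    rw [hs, hs] at this
    simpa using this

theorem exists_injective_of_hom {M : Type*} [AddCommGroup M] {k : ℕ} {a : Fin k → ℕ}
    (e : M ≃+ ℤ × ((i : Fin k) → ZMod (a i))) (R : Type*) [AddCommGroup R] :
    ∃ Φ : (M →+ R) → R × (Fin k → R), Function.Injective Φ := by
  classical
  refine ⟨fun φ => (φ (e.symm (1, 0)), fun i => φ (e.symm (0, Pi.single i 1))), ?_⟩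
  intro φ φ' hφ
  rw [Prod.ext_iff] at hφ
  obtain ⟨h1, h2⟩ := hφ
  let θ : (M →+ R) → ((ℤ × ((i : Fin k) → ZMod (a i))) →+ R) := fun φ =>
    φ.comp e.symm.toAddMonoidHom
  have hint : (θ φ).comp (AddMonoidHom.inl _ _) = (θ φ').comp (AddMonoidHom.inl _ _) :=
    AddMonoidHom.ext_int h1
  have hpi : (θ φ).comp (AddMonoidHom.inr _ _) = (θ φ').comp (AddMonoidHom.inr _ _) := by
    refine AddMonoidHom.functions_ext' _ _ _ fun i => ?_
    ext x
    obtain ⟨n, rfl⟩ := ZMod.intCast_surjective x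
    have hn : ((n : ℤ) : ZMod (a i)) = n • 1 := by simp
    rw [hn, map_zsmul, map_zsmul]
    exact congrArg (n • ·) (congrFun h2 i)
  ext x
  obtain ⟨⟨n, z⟩, rfl⟩ := e.symm.surjective x
  have hsplit : ((n, z) : ℤ × ((i : Fin k) → ZMod (a i))) = (n, 0) + (0, z) := by simp
  rw [hsplit, map_add, map_add, map_add]
  exact congrArg₂ (· + ·) (DFunLike.congr_fun hint n) (DFunLike.congr_fun hpi z)

namespace SimpleGraph

/-! ### The cokernel of the generalized Laplacian -/

section Cokernel

variable {V : Type*} [Fintype V] [DecidableEq V] (G : SimpleGraph V) [DecidableRel G.Adj]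
  (d : V → ℤ)

/-- The cokernel of the generalized Laplacian. -/
abbrev LaplacianCokernel : Type _ :=
  (V → ℤ) ⧸ LinearMap.range (G.generalizedLaplacian d).mulVecLin

/-- The class of a vertex in the cokernel of the generalized Laplacian. -/
def vertexClass (v : V) : G.LaplacianCokernel d :=
  Submodule.Quotient.mk (Pi.single v 1)

variable {G d}

theorem generalizedLaplacian_mulVec (x : V → ℤ) (v : V) :
    ((G.generalizedLaplacian d).mulVec x) v = d v * x v - ∑ u ∈ G.neighborFinset v, x u := by
  rw [generalizedLaplacian, Matrix.sub_mulVec, Pi.sub_apply, Matrix.mulVec_diagonal,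
    adjMatrix_mulVec_apply]

theorem vertexClass_relation (v : V) :
    d v • G.vertexClass d v = ∑ u ∈ G.neighborFinset v, G.vertexClass d u := by
  have h : d v • (Pi.single v 1 : V → ℤ) - ∑ u ∈ G.neighborFinset v, Pi.single u 1 ∈
      LinearMap.range (G.generalizedLaplacian d).mulVecLin := by
    refine ⟨Pi.single v 1, ?_⟩
    ext w
    rw [Matrix.mulVecLin_apply, generalizedLaplacian_mulVec]
    simp only [Pi.sub_apply, Pi.smul_apply, smul_eq_mul, Finset.sum_apply, Pi.single_apply]
    by_cases hwv : w = v
    · subst hwv; simp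
    · simp [hwv, G.adj_comm]
  rw [← Submodule.Quotient.mk_eq_zero, Submodule.Quotient.mk_sub, sub_eq_zero] at h
  have hsum := map_sum (LinearMap.range (G.generalizedLaplacian d).mulVecLin).mkQ
    (fun u => (Pi.single u 1 : V → ℤ)) (G.neighborFinset v)
  exact h.trans hsum

theorem exists_eq_sum_vertexClass (x : G.LaplacianCokernel d) :
    ∃ c : V → ℤ, x = ∑ v, c v • G.vertexClass d v := by
  obtain ⟨c, rfl⟩ := Submodule.Quotient.mk_surjective _ x
  refine ⟨c, ?_⟩
  have hc : c = ∑ v, c v • (Pi.single v 1 : V → ℤ) := by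
    ext w
    simp [Finset.sum_apply, Pi.single_apply]
  have hsum := map_sum (LinearMap.range (G.generalizedLaplacian d).mulVecLin).mkQ
    (fun v => c v • (Pi.single v 1 : V → ℤ)) Finset.univ
  rw [← hc] at hsum
  exact hsum

theorem isKernelVector_of_hom {R : Type*} [Ring R] (φ : G.LaplacianCokernel d →+ R) :
    G.IsKernelVector d fun v => φ (G.vertexClass d v) := by
  intro v
  have := congrArg φ (vertexClass_relation (G := G) (d := d) v)
  rw [map_zsmul, map_sum, zsmul_eq_mul] at this
  exact this

theorem hom_ext {R : Type*} [AddCommGroup R] {φ φ' : G.LaplacianCokernel d →+ R}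
    (h : ∀ v, φ (G.vertexClass d v) = φ' (G.vertexClass d v)) : φ = φ' := by
  ext x
  obtain ⟨c, rfl⟩ := exists_eq_sum_vertexClass x
  simp [map_sum, h]

/-- The functional with coefficients `y` kills the image of the Laplacian because that matrix is
symmetric. -/
theorem exists_hom_of_isKernelVector {R : Type*} [CommRing R] {y : V → R}
    (hy : G.IsKernelVector d y) :
    ∃ φ : G.LaplacianCokernel d →+ R, ∀ v, φ (G.vertexClass d v) = y v := by
  let f : (V → ℤ) →ₗ[ℤ] R := ∑ v, (LinearMap.proj v).smulRight (y v)
  have hf : ∀ x, f x = ∑ v, (x v : R) * y v := fun x => by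
    simp [f, LinearMap.sum_apply, zsmul_eq_mul]
  have hle : LinearMap.range (G.generalizedLaplacian d).mulVecLin ≤ LinearMap.ker f := by
    rintro _ ⟨x, rfl⟩
    rw [LinearMap.mem_ker, hf]
    simp only [Matrix.mulVecLin_apply, generalizedLaplacian_mulVec]
    push_cast
    simp only [sub_mul, Finset.sum_sub_distrib, Finset.sum_mul]
    rw [sub_eq_zero]
    have h1 : ∀ v, ∀ g : V → R, ∑ u ∈ G.neighborFinset v, g u =
        ∑ u, if G.Adj v u then g u else 0 := fun v g => by
      rw [← Finset.sum_filter]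
      congr 1
      ext u
      simp
    have h2 : ∀ v, (d v : R) * (x v : R) * y v = ∑ u, if G.Adj v u then (x v : R) * y u else 0 := by
      intro v
      rw [mul_right_comm, hy v, Finset.sum_mul, h1]
      exact Finset.sum_congr rfl fun u _ => by split_ifs <;> ring
    simp only [h1, h2]
    rw [Finset.sum_comm]
    exact Finset.sum_congr rfl fun u _ => Finset.sum_congr rfl fun v _ => if_congr (G.adj_comm _ _) rfl rfl
  refine ⟨(Submodule.liftQ _ f hle).toAddMonoidHom, fun v => ?_⟩
  change f (Pi.single v 1) = _
  rw [hf]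
  simp [Pi.single_apply]

end Cokernel

/-! ### Critical groups of trees -/

section CriticalGroup

variable {V : Type u} [Fintype V] [DecidableEq V] {G : SimpleGraph V} [DecidableRel G.Adj]
  {ρ : V} {p : V → V} {depth : V → ℕ}

theorem ArithmeticalStructure.isKernelVector (A : G.ArithmeticalStructure) :
    G.IsKernelVector A.d A.r := by
  intro v
  have := congrFun A.laplacian_mulVec v
  rw [generalizedLaplacian_mulVec] at this
  simpa [sub_eq_zero] using this

/-- Multiply the relation at `v` by `r v`; by induction each child class is replaced by a multiple
of the class of `v`, and the kernel equation for `r` leaves the coefficient `r (p v)`. -/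
theorem ArithmeticalStructure.smul_vertexClass_parent (A : G.ArithmeticalStructure)
    (h : G.IsParentMap ρ p depth) : ∀ v, v ≠ ρ →
      A.r v • G.vertexClass A.d (p v) = A.r (p v) • G.vertexClass A.d v := by
  refine h.bottom_up fun v ih hv => ?_
  have h1 := vertexClass_relation (G := G) (d := A.d) v
  have h2 := A.isKernelVector v
  rw [h.sum_neighborFinset, if_neg hv] at h1 h2
  have h3 : A.r v • ∑ w ∈ childFinset ρ p v, G.vertexClass A.d w =
      (∑ w ∈ childFinset ρ p v, A.r w) • G.vertexClass A.d v := by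
    rw [Finset.smul_sum, Finset.sum_smul]
    refine Finset.sum_congr rfl fun w hw => ?_
    obtain ⟨hw1, hw2⟩ := mem_childFinset.1 hw
    have := ih w hw1 hw2 hw1
    rw [hw2] at this
    exact this.symm
  have h4 := congrArg (A.r v • ·) h1
  simp only [smul_add, h3] at h4
  rw [← sub_eq_iff_eq_add, smul_smul, ← sub_smul] at h4
  rw [← h4]
  congr 1
  simp only [Int.cast_id] at h2
  linarith

/-- Multiplying by `r (p v)` turns the element into `r v` times the corresponding element at the
parent. -/
theorem ArithmeticalStructure.sub_mem_torsion (A : G.ArithmeticalStructure)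
    (h : G.IsParentMap ρ p depth) : ∀ v,
      A.r ρ • G.vertexClass A.d v - A.r v • G.vertexClass A.d ρ ∈ A.criticalGroup := by
  refine h.top_down fun v ih => ?_
  by_cases hv : v = ρ
  · rw [hv, sub_self]
    exact zero_mem _
  have h1 := ih hv
  rw [Submodule.mem_torsion_iff] at h1 ⊢
  obtain ⟨c, hc⟩ := h1
  have hp0 : A.r (p v) ≠ 0 := (A.r_pos _).ne'
  refine ⟨c * ⟨A.r (p v), mem_nonZeroDivisors_of_ne_zero hp0⟩, ?_⟩
  have h2 := A.smul_vertexClass_parent h v hv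
  have h3 : A.r (p v) • (A.r ρ • G.vertexClass A.d v - A.r v • G.vertexClass A.d ρ) =
      A.r v • (A.r ρ • G.vertexClass A.d (p v) - A.r (p v) • G.vertexClass A.d ρ) := by
    rw [smul_sub, smul_sub, smul_comm, ← h2, smul_comm (A.r ρ), smul_comm (A.r (p v)) (A.r v)]
  rw [mul_smul]
  change c • (A.r (p v) • (A.r ρ • G.vertexClass A.d v - A.r v • G.vertexClass A.d ρ)) = 0
  rw [h3, smul_comm, hc, smul_zero]

/-- The vector `r` induces a map to `ℤ`, surjective by coprimality. If it kills `x`, then `r ρ • x`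
is a combination of the torsion elements of `sub_mem_torsion`, so its kernel is the torsion. -/
theorem ArithmeticalStructure.exists_equiv (A : G.ArithmeticalStructure)
    (h : G.IsParentMap ρ p depth) :
    Nonempty (G.LaplacianCokernel A.d ≃+ ℤ × A.criticalGroup) := by
  obtain ⟨ψ, hψ⟩ := exists_hom_of_isKernelVector A.isKernelVector
  obtain ⟨m₀, hm₀⟩ : ∃ m₀, ψ m₀ = 1 := by
    obtain ⟨g, hg⟩ := Int.subgroup_cyclic ψ.range
    have hdvd : ∀ v, g ∣ A.r v := fun v => by
      have : A.r v ∈ ψ.range := ⟨_, hψ v⟩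
      rw [hg, AddSubgroup.mem_closure_singleton] at this
      obtain ⟨n, hn⟩ := this
      exact ⟨n, by rw [← hn, smul_eq_mul, mul_comm]⟩
    have hu := A.r_coprime g hdvd
    have : (1 : ℤ) ∈ ψ.range := by
      rw [hg, AddSubgroup.mem_closure_singleton]
      obtain ⟨u, hu⟩ := hu.dvd (a := 1)
      exact ⟨u, by rw [hu, smul_eq_mul, mul_comm]⟩
    exact this
  have hker : ψ.ker = A.criticalGroup.toAddSubgroup := by
    ext x
    rw [AddMonoidHom.mem_ker, Submodule.mem_toAddSubgroup]
    constructor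
    · intro hx
      have key : A.r ρ • x ∈ A.criticalGroup := by
        obtain ⟨c, rfl⟩ := exists_eq_sum_vertexClass x
        simp only [map_sum, map_zsmul, hψ, smul_eq_mul] at hx
        have : A.r ρ • ∑ v, c v • G.vertexClass A.d v =
            ∑ v, c v • (A.r ρ • G.vertexClass A.d v - A.r v • G.vertexClass A.d ρ) := by
          simp only [smul_sub, Finset.sum_sub_distrib, Finset.smul_sum, smul_smul,
            ← Finset.sum_smul, hx, zero_smul, sub_zero]
          exact Finset.sum_congr rfl fun v _ => by rw [mul_comm]
        rw [this]
        exact Submodule.sum_mem _ fun v _ => Submodule.smul_mem _ _ (A.sub_mem_torsion h v)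
      rw [Submodule.mem_torsion_iff] at key ⊢
      obtain ⟨c, hc⟩ := key
      refine ⟨c * ⟨A.r ρ, mem_nonZeroDivisors_of_ne_zero (A.r_pos ρ).ne'⟩, ?_⟩
      rw [mul_smul]
      exact hc
    · intro hx
      rw [Submodule.mem_torsion_iff] at hx
      obtain ⟨c, hc⟩ := hx
      have := congrArg ψ hc
      change ψ ((c : ℤ) • x) = ψ 0 at this
      rw [map_zsmul, map_zero, smul_eq_mul, mul_eq_zero] at this
      exact this.resolve_left (nonZeroDivisors.ne_zero c.2)
  refine ⟨(ψ.equivIntProdKer m₀ hm₀).trans (AddEquiv.prodCongr (AddEquiv.refl _) ?_)⟩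
  exact AddEquiv.addSubgroupCongr hker

theorem ArithmeticalStructure.exists_hasInvariantFactorCount (A : G.ArithmeticalStructure) :
    ∃ k, HasInvariantFactorCount A.criticalGroup k := by
  have : Finite A.criticalGroup :=
    Module.finite_of_fg_torsion _ Submodule.torsion_isTorsion
  exact _root_.exists_hasInvariantFactorCount _

/-- Counting: at least `q ^ (k + 1)` homomorphisms to `ZMod q`, each determined by its values on
`S`. -/
theorem ArithmeticalStructure.invariantFactorCount_lt (A : G.ArithmeticalStructure)
    (h : G.IsParentMap ρ p depth) {k : ℕ} (hk : HasInvariantFactorCount A.criticalGroup k)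
    {S : Finset V} (hS : ∀ (R : Type) [CommRing R] (y : V → R), G.IsKernelVector A.d y →
      (∀ v ∈ S, y v = 0) → ∀ v, y v = 0) : k + 1 ≤ S.card := by
  obtain ⟨e⟩ := A.exists_equiv h
  obtain ⟨a, ha, hdvd, ⟨f⟩⟩ := hk
  obtain ⟨q, hq, Φ, hΦ⟩ := exists_prime_injective_hom ha hdvd
    (e.trans (AddEquiv.prodCongr (AddEquiv.refl _) f))
  have := Fact.mk hq
  let g : ZMod q × (Fin k → ZMod q) → (S → ZMod q) := fun c v => Φ c (G.vertexClass A.d v)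
  have hg : Function.Injective g := by
    intro c c' hc
    refine hΦ (hom_ext fun v => sub_eq_zero.1 ?_)
    refine hS _ (fun v => (Φ c - Φ c') (G.vertexClass A.d v)) (isKernelVector_of_hom _)
      (fun v hv => ?_) v
    exact sub_eq_zero.2 (congrFun hc ⟨v, hv⟩)
  have := Fintype.card_le_of_injective g hg
  simp only [Fintype.card_prod, Fintype.card_pi, ZMod.card, Finset.prod_const,
    Finset.card_univ, Fintype.card_fin, Fintype.card_coe] at this
  rw [← pow_succ'] at this
  exact (Nat.pow_le_pow_iff_right hq.one_lt).1 this

/-- The converse count: at most `2 ^ (k + 1)` homomorphisms to `ZMod 2`, at least one for each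
assignment on `S`. -/
theorem ArithmeticalStructure.card_le_of_extension (A : G.ArithmeticalStructure)
    (h : G.IsParentMap ρ p depth) {k : ℕ} (hk : HasInvariantFactorCount A.criticalGroup k)
    {S : Finset V} (hS : ∀ f : V → ZMod 2, ∃ y : V → ZMod 2, G.IsKernelVector A.d y ∧
      ∀ v ∈ S, y v = f v) : S.card ≤ k + 1 := by
  obtain ⟨e⟩ := A.exists_equiv h
  obtain ⟨a, ha, hdvd, ⟨f⟩⟩ := hk
  obtain ⟨Φ, hΦ⟩ := exists_injective_of_hom
    (e.trans (AddEquiv.prodCongr (AddEquiv.refl _) f)) (ZMod 2)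
  have hex : ∀ f : S → ZMod 2, ∃ φ : G.LaplacianCokernel A.d →+ ZMod 2,
      ∀ v : S, φ (G.vertexClass A.d v) = f v := by
    intro f
    obtain ⟨y, hy, hyf⟩ := hS fun v => if hv : v ∈ S then f ⟨v, hv⟩ else 0
    obtain ⟨φ, hφ⟩ := exists_hom_of_isKernelVector hy
    exact ⟨φ, fun v => by rw [hφ, hyf v v.2, dif_pos v.2]⟩
  choose φ hφ using hex
  have hg : Function.Injective fun f => Φ (φ f) := by
    intro f f' hf
    have := hΦ hf
    ext v
    rw [← hφ f v, ← hφ f' v, this]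
  have := Fintype.card_le_of_injective _ hg
  simp only [Fintype.card_prod, Fintype.card_pi, ZMod.card, Finset.prod_const,
    Finset.card_univ, Fintype.card_fin, Fintype.card_coe] at this
  rw [← pow_succ'] at this
  exact (Nat.pow_le_pow_iff_right one_lt_two).1 this

end CriticalGroup

end SimpleGraph

namespace SimpleGraph

/-! ### Arithmetical structures with prescribed number of invariant factors -/

theorem sum_range_two_pow_min (j l : ℕ) :
    1 + ∑ i ∈ Finset.range (j + 1 + l), 2 ^ min i (j + 1) = (l + 1) * 2 ^ (j + 1) := by
  induction l with
  | zero =>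
    have h : ∀ n ≤ j + 1, 1 + ∑ i ∈ Finset.range n, 2 ^ min i (j + 1) = 2 ^ n := by
      intro n hn
      induction n with
      | zero => simp
      | succ n ih =>
        rw [Finset.sum_range_succ, ← add_assoc, ih (by omega), min_eq_left (by omega), pow_succ]
        ring
    simpa using h (j + 1) le_rfl
  | succ l ih =>
    rw [← add_assoc, Finset.sum_range_succ, ← add_assoc, ih, min_eq_right (by omega)]
    ring

theorem exists_le_sum_eq {ι : Type*} (s : Finset ι) (c : ι → ℕ) {t : ℕ} (ht : t ≤ ∑ i ∈ s, c i) :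
    ∃ j : ι → ℕ, (∀ i ∈ s, j i ≤ c i) ∧ ∑ i ∈ s, j i = t := by
  classical
  induction s using Finset.induction_on generalizing t with
  | empty => exact ⟨0, by simp, by simpa using (Nat.le_zero.1 ht).symm⟩
  | insert a s ha ih =>
    rw [Finset.sum_insert ha] at ht
    obtain ⟨j, hj, hsum⟩ := ih (t := t - c a) (by omega)
    refine ⟨Function.update j a (min t (c a)), fun i hi => ?_, ?_⟩
    · rcases eq_or_ne i a with rfl | hia
      · simp
      · rw [Function.update_of_ne hia]
        exact hj i ((Finset.mem_insert.1 hi).resolve_left hia)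
    · rw [Finset.sum_insert ha, Function.update_self, Finset.sum_update_of_notMem ha, hsum]
      omega

theorem IsParentMap.exists_rec {V : Type*} {G : SimpleGraph V} {ρ : V} {p : V → V} {depth : V → ℕ}
    (h : G.IsParentMap ρ p depth) {α : Type*} (a : α) (F : V → α → α) :
    ∃ s : V → α, s ρ = a ∧ ∀ v, v ≠ ρ → s v = F v (s (p v)) := by
  classical
  have wf : WellFounded fun u v => depth u < depth v := InvImage.wf depth wellFounded_lt
  refine ⟨wf.fix fun v ih => if hv : v = ρ then a else F v (ih (p v) (h.depth_lt v hv)), ?_, ?_⟩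
  · rw [wf.fix_eq, dif_pos rfl]
  · intro v hv
    rw [wf.fix_eq, dif_neg hv]

/-- Recursion on the values at parent and grandparent, needed because `freeRatio` relates a vertex
to its grandparent. A missing grandparent is replaced by the default `a`. -/
theorem IsParentMap.exists_rec_two {V : Type*} {G : SimpleGraph V} {ρ : V} {p : V → V}
    {depth : V → ℕ} (h : G.IsParentMap ρ p depth) {α : Type*} (a : α) (F : V → α → α → α) :
    ∃ s : V → α, s ρ = a ∧ ∀ v, v ≠ ρ →
      (p v = ρ → s v = F v (s (p v)) a) ∧ (p v ≠ ρ → s v = F v (s (p v)) (s (p (p v)))) := by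
  obtain ⟨s, hs, hs'⟩ := h.exists_rec (a, a) fun v x => (F v x.1 x.2, x.1)
  refine ⟨fun v => (s v).1, congrArg Prod.fst hs, fun v hv => ⟨fun hpv => ?_, fun hpv => ?_⟩⟩
  · simp only [hs' v hv, hpv, hs]
  · simp only [hs' v hv, hs' (p v) hpv]

/-- `j` prescribes the contribution of every branch vertex to the number of invariant factors, and
`idx` numbers the children of a branch vertex that are not branch vertices. -/
structure IsBranchLabelling {V : Type*} [Fintype V] [DecidableEq V] (ρ : V) (p : V → V)
    (Q : Finset V) (j idx : V → ℕ) : Prop where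
  le : ∀ v ∈ Q, j v + 1 ≤ (freeChildFinset ρ p Q v).card
  inj : ∀ v, Set.InjOn idx (freeChildFinset ρ p Q v)
  image : ∀ v, (freeChildFinset ρ p Q v).image idx =
    Finset.range (freeChildFinset ρ p Q v).card

theorem exists_isBranchLabelling {V : Type*} [Fintype V] [DecidableEq V] (ρ : V) (p : V → V)
    (Q : Finset V) (j : V → ℕ) (hj : ∀ v ∈ Q, j v + 1 ≤ (freeChildFinset ρ p Q v).card) :
    ∃ idx, IsBranchLabelling ρ p Q j idx := by
  let idx : V → ℕ := fun w =>
    if hw : w ∈ freeChildFinset ρ p Q (p w) then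
      ((freeChildFinset ρ p Q (p w)).equivFin ⟨w, hw⟩ : ℕ) else 0
  have hidx : ∀ v w (hw : w ∈ freeChildFinset ρ p Q v),
      idx w = ((freeChildFinset ρ p Q v).equivFin ⟨w, hw⟩ : ℕ) := by
    intro v w hw
    obtain rfl := (mem_freeChildFinset.1 hw).2.1
    simp only [idx]
    rw [dif_pos hw]
  refine ⟨idx, hj, fun v w hw w' hw' heq => ?_, fun v => ?_⟩
  · rw [hidx v w hw, hidx v w' hw', Fin.val_inj, EmbeddingLike.apply_eq_iff_eq] at heq
    exact congrArg Subtype.val heq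
  · ext i
    rw [Finset.mem_image, Finset.mem_range]
    constructor
    · rintro ⟨w, hw, rfl⟩
      rw [hidx v w hw]
      exact Fin.is_lt _
    · intro hi
      refine ⟨(freeChildFinset ρ p Q v).equivFin.symm ⟨i, hi⟩, Subtype.coe_prop _, ?_⟩
      rw [hidx v _ (Subtype.coe_prop _)]
      simp

/-- The ratio `r v / r (p v)` at a branch vertex `v`. -/
def branchRatio {V : Type*} (j : V → ℕ) (v : V) : ℕ := 2 ^ (j v + 1)

/-- The ratio `r w / r (p (p w))` at a child `w` of a branch vertex, if `w` is not itself a branch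
vertex. -/
def freeRatio {V : Type*} (p : V → V) (j idx : V → ℕ) (w : V) : ℕ :=
  2 ^ min (idx w) (j (p w) + 1)

/-- The ratio `r (p w) / r w` at a vertex `w` that is not a branch vertex. -/
def parentRatio {V : Type*} [DecidableEq V] (p : V → V) (Q : Finset V) (j idx : V → ℕ) (w : V) :
    ℕ :=
  if p w ∈ Q then 2 ^ (j (p w) + 1 - min (idx w) (j (p w) + 1)) else 1

/-- The diagonal `d` of the arithmetical structure defined by a branch labelling. -/
def branchDiagonal {V : Type*} [Fintype V] [DecidableEq V] (ρ : V) (p : V → V) (Q : Finset V)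
    (j idx : V → ℕ) (v : V) : ℕ :=
  ∑ w ∈ branchChildFinset ρ p Q v, branchRatio j w +
    if v ∈ Q then (freeChildFinset ρ p Q v).card - j v
    else (if v = ρ then 0 else parentRatio p Q j idx v) + (freeChildFinset ρ p Q v).card

namespace IsBranchLabelling

section

variable {V : Type*} [Fintype V] [DecidableEq V] {ρ : V} {p : V → V} {Q : Finset V}
  {j idx : V → ℕ} {v w : V}

theorem sum_freeChildFinset (hl : IsBranchLabelling ρ p Q j idx) {M : Type*} [AddCommMonoid M]
    (g : ℕ → M) (v : V) : ∑ w ∈ freeChildFinset ρ p Q v, g (idx w) =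
      ∑ i ∈ Finset.range (freeChildFinset ρ p Q v).card, g i := by
  rw [← hl.image v, Finset.sum_image (hl.inj v)]

/-- This divisibility by `branchRatio j v` makes the diagonal entry at `v` an integer; the quotient
is the `card - j v` in `branchDiagonal`. -/
theorem one_add_sum_freeRatio (hl : IsBranchLabelling ρ p Q j idx) (hv : v ∈ Q) :
    1 + ∑ w ∈ freeChildFinset ρ p Q v, freeRatio p j idx w =
      ((freeChildFinset ρ p Q v).card - j v) * branchRatio j v := by
  have h1 : ∑ w ∈ freeChildFinset ρ p Q v, freeRatio p j idx w =
      ∑ w ∈ freeChildFinset ρ p Q v, 2 ^ min (idx w) (j v + 1) :=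
    Finset.sum_congr rfl fun w hw => by rw [freeRatio, (mem_freeChildFinset.1 hw).2.1]
  obtain ⟨l, hk⟩ := Nat.exists_eq_add_of_le (hl.le v hv)
  rw [h1, hl.sum_freeChildFinset (fun i => 2 ^ min i (j v + 1)), hk, sum_range_two_pow_min,
    branchRatio]
  congr 1
  omega

theorem freeRatio_mul_parentRatio (hw : w ∈ freeChildFinset ρ p Q v) (hv : v ∈ Q) :
    freeRatio p j idx w * parentRatio p Q j idx w = branchRatio j v := by
  obtain ⟨-, rfl, -⟩ := mem_freeChildFinset.1 hw
  rw [freeRatio, parentRatio, if_pos hv, ← pow_add, branchRatio]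
  congr 1
  omega

variable {G : SimpleGraph V} [DecidableRel G.Adj] {depth : V → ℕ} {R : Type*} [CommRing R]
  {y : V → R}

theorem isKernelVector (h : G.IsParentMap ρ p depth) (hQ : IsBranchSet ρ p Q)
    (h1 : ∀ v, v ≠ ρ → v ∈ Q → y v = branchRatio j v * y (p v))
    (h2 : ∀ v, v ≠ ρ → v ∉ Q → y (p v) = parentRatio p Q j idx v * y v)
    (h3 : ∀ v ∈ Q, (((freeChildFinset ρ p Q v).card - j v : ℕ) : R) * y v =
      y (p v) + ∑ w ∈ freeChildFinset ρ p Q v, y w) :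
    G.IsKernelVector (fun v => (branchDiagonal ρ p Q j idx v : ℤ)) y := by
  intro v
  rw [h.sum_neighborFinset, sum_childFinset (Q := Q), Int.cast_natCast, branchDiagonal]
  have hb : ∑ w ∈ branchChildFinset ρ p Q v, y w =
      (∑ w ∈ branchChildFinset ρ p Q v, (branchRatio j w : R)) * y v := by
    rw [Finset.sum_mul]
    refine Finset.sum_congr rfl fun w hw => ?_
    obtain ⟨hw1, rfl, hw3⟩ := mem_branchChildFinset.1 hw
    exact h1 w hw1 hw3
  rw [hb, Nat.cast_add, Nat.cast_sum, add_mul]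
  by_cases hv : v ∈ Q
  · rw [if_pos hv, if_neg ((hQ v).1 hv).1, h3 v hv]
    ring
  · rw [if_neg hv]
    have hf : ∑ w ∈ freeChildFinset ρ p Q v, y w = (freeChildFinset ρ p Q v).card * y v := by
      rw [← nsmul_eq_mul]
      refine Finset.sum_eq_card_nsmul fun w hw => ?_
      obtain ⟨hw1, rfl, hw3⟩ := mem_freeChildFinset.1 hw
      rw [h2 w hw1 hw3, parentRatio, if_neg hv]
      simp
    rw [hf]
    by_cases hvρ : v = ρ
    · simp only [if_pos hvρ]
      push_cast
      ring
    · simp only [if_neg hvρ]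
      rw [h2 v hvρ hv]
      push_cast
      ring

/-- All kernel vectors, over any commutative ring, obey the ratios built into `r`. At a branch
vertex the relation is multiplied by `branchRatio j v`, which expresses the free children through `y
v` without any division; `one_add_sum_freeRatio` then cancels all but one `y v`. -/
theorem eq_of_isKernelVector (hl : IsBranchLabelling ρ p Q j idx) (h : G.IsParentMap ρ p depth)
    (hy : G.IsKernelVector (fun v => (branchDiagonal ρ p Q j idx v : ℤ)) y) : ∀ v, v ≠ ρ →
      (v ∈ Q → y v = branchRatio j v * y (p v)) ∧
      (v ∉ Q → y (p v) = parentRatio p Q j idx v * y v) := by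
  refine h.bottom_up fun v ih hvρ => ?_
  have hrel := h.kernelVector_eq Q hy v
  rw [Int.cast_natCast, branchDiagonal, if_neg hvρ] at hrel
  have hb : ∑ w ∈ branchChildFinset ρ p Q v, y w =
      (∑ w ∈ branchChildFinset ρ p Q v, (branchRatio j w : R)) * y v := by
    rw [Finset.sum_mul]
    refine Finset.sum_congr rfl fun w hw => ?_
    obtain ⟨hw1, hw2, hw3⟩ := mem_branchChildFinset.1 hw
    rw [(ih w hw1 hw2 hw1).1 hw3, hw2]
  rw [hb, Nat.cast_add, Nat.cast_sum, add_mul] at hrel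
  constructor
  · intro hv
    rw [if_pos hv, if_neg hvρ] at hrel
    have hf : (branchRatio j v : R) * ∑ w ∈ freeChildFinset ρ p Q v, y w =
        (∑ w ∈ freeChildFinset ρ p Q v, (freeRatio p j idx w : R)) * y v := by
      rw [Finset.sum_mul, Finset.mul_sum]
      refine Finset.sum_congr rfl fun w hw => ?_
      obtain ⟨hw1, hw2, hw3⟩ := mem_freeChildFinset.1 hw
      rw [← freeRatio_mul_parentRatio (idx := idx) (j := j) hw hv, Nat.cast_mul, mul_assoc,
        ← (ih w hw1 hw2 hw1).2 hw3, hw2]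
    have hsum : (1 : R) + ∑ w ∈ freeChildFinset ρ p Q v, (freeRatio p j idx w : R) =
        (((freeChildFinset ρ p Q v).card - j v : ℕ) : R) * branchRatio j v := by
      exact_mod_cast congrArg (Nat.cast (R := R)) (hl.one_add_sum_freeRatio hv)
    linear_combination (branchRatio j v : R) * hrel + y v * hsum + hf
  · intro hv
    simp only [if_neg hv, if_neg hvρ] at hrel
    have hf : ∑ w ∈ freeChildFinset ρ p Q v, y w = (freeChildFinset ρ p Q v).card * y v := by
      rw [← nsmul_eq_mul]
      refine Finset.sum_eq_card_nsmul fun w hw => ?_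
      obtain ⟨hw1, hw2, hw3⟩ := mem_freeChildFinset.1 hw
      have := (ih w hw1 hw2 hw1).2 hw3
      rw [hw2, parentRatio, hw2, if_neg hv] at this
      simpa using this.symm
    rw [hf] at hrel
    push_cast at hrel
    linear_combination -hrel

/-- The root together with the children of branch vertices numbered from `1` to `j`. -/
def freeSet (ρ : V) (p : V → V) (Q : Finset V) (j idx : V → ℕ) : Finset V :=
  insert ρ (Q.biUnion fun v => {w ∈ freeChildFinset ρ p Q v | 1 ≤ idx w ∧ idx w ≤ j v})

theorem card_freeSet (hl : IsBranchLabelling ρ p Q j idx) :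
    (freeSet ρ p Q j idx).card = ∑ v ∈ Q, j v + 1 := by
  rw [freeSet, Finset.card_insert_of_notMem, Finset.card_biUnion]
  · congr 1
    refine Finset.sum_congr rfl fun v hv => ?_
    rw [Finset.card_filter,
      hl.sum_freeChildFinset (fun i => if 1 ≤ i ∧ i ≤ j v then 1 else 0), ← Finset.card_filter]
    have h1 : (Finset.range (freeChildFinset ρ p Q v).card).filter
        (fun i => 1 ≤ i ∧ i ≤ j v) = Finset.Icc 1 (j v) := by
      have := hl.le v hv
      ext i
      simp only [Finset.mem_filter, Finset.mem_range, Finset.mem_Icc]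
      omega
    rw [h1, Nat.card_Icc]
    omega
  · intro u _ v _ huv
    refine Finset.disjoint_left.2 fun w hu hv => ?_
    simp only [Finset.mem_filter, mem_freeChildFinset] at hu hv
    exact huv (hu.1.2.1.symm.trans hv.1.2.1)
  · simp

theorem eq_zero_of_isKernelVector (hl : IsBranchLabelling ρ p Q j idx)
    (h : G.IsParentMap ρ p depth) (hQ : IsBranchSet ρ p Q)
    (hy : G.IsKernelVector (fun v => (branchDiagonal ρ p Q j idx v : ℤ)) y)
    (hS : ∀ v ∈ freeSet ρ p Q j idx, y v = 0) (v : V) : y v = 0 := by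
  have hrel := hl.eq_of_isKernelVector h hy
  refine (h.top_down (P := fun v => y v = 0 ∧ (v ≠ ρ → y (p v) = 0))
    (fun v ih => ⟨?_, fun hv => (ih hv).1⟩) v).1
  by_cases hvρ : v = ρ
  · rw [hvρ]
    exact hS ρ (Finset.mem_insert_self _ _)
  obtain ⟨hpv, hppv⟩ := ih hvρ
  by_cases hv : v ∈ Q
  · rw [(hrel v hvρ).1 hv, hpv, mul_zero]
  by_cases hpvQ : p v ∈ Q
  -- Numbers `1, ..., j` lie in `freeSet`; beyond `j` the parent ratio is 1, so the child equals its
  -- vanishing parent. Only number 0 remains, and the relation at the branch vertex determines it.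
  · have key : ∀ w ∈ freeChildFinset ρ p Q (p v), idx w ≠ 0 → y w = 0 := by
      intro w hw hw0
      obtain ⟨hw1, hw2, hw3⟩ := mem_freeChildFinset.1 hw
      by_cases hwj : idx w ≤ j (p v)
      · refine hS w (Finset.mem_insert_of_mem (Finset.mem_biUnion.2 ⟨p v, hpvQ, ?_⟩))
        exact Finset.mem_filter.2 ⟨hw, by omega, hwj⟩
      · have h1 := (hrel w hw1).2 hw3
        rw [hw2, hpv, parentRatio, hw2, if_pos hpvQ, min_eq_right (by omega), Nat.sub_self] at h1
        simpa using h1.symm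
    have hmem : v ∈ freeChildFinset ρ p Q (p v) := mem_freeChildFinset.2 ⟨hvρ, rfl, hv⟩
    by_cases hv0 : idx v = 0
    · have h1 := h.kernelVector_eq Q hy (p v)
      have hpρ := ((hQ _).1 hpvQ).1
      rw [hpv, if_neg hpρ, hppv hpρ, Finset.sum_eq_zero, Finset.sum_eq_single_of_mem v hmem] at h1
      · simpa using h1.symm
      · intro w hw hwv
        refine key w hw fun hw0 => hwv (hl.inj (p v) hw hmem (hw0.trans hv0.symm))
      · intro w hw
        obtain ⟨hw1, hw2, hw3⟩ := mem_branchChildFinset.1 hw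
        rw [(hrel w hw1).1 hw3, hw2, hpv, mul_zero]
    · exact key v hmem hv0
  · have h1 := (hrel v hvρ).2 hv
    rw [hpv, parentRatio, if_neg hpvQ] at h1
    simpa using h1.symm

/-- Modulo 2 the branch ratios vanish, so `y = 0` on `Q`, and the parent ratios of the children
numbered `0, ..., j` vanish too, leaving these children unconstrained except by the relation at
their parent. Child 0 absorbs that relation; the others are arbitrary. -/
theorem exists_isKernelVector_zmod_two (hl : IsBranchLabelling ρ p Q j idx)
    (h : G.IsParentMap ρ p depth) (hQ : IsBranchSet ρ p Q) (f : V → ZMod 2) :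
    ∃ y : V → ZMod 2, G.IsKernelVector (fun v => (branchDiagonal ρ p Q j idx v : ℤ)) y ∧
      ∀ v ∈ freeSet ρ p Q j idx, y v = f v := by
  have h2 : (2 : ZMod 2) = 0 := rfl
  let σ : V → ZMod 2 := fun v =>
    ∑ w ∈ freeChildFinset ρ p Q v, if 1 ≤ idx w ∧ idx w ≤ j v then f w else 0
  obtain ⟨y, hyρ, hy⟩ := h.exists_rec_two (f ρ) fun v a b =>
    if v ∈ Q then 0 else if p v ∈ Q then
      if idx v = 0 then b + σ (p v) else if 1 ≤ idx v ∧ idx v ≤ j (p v) then f v else 0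
    else a
  have hyQ : ∀ v ∈ Q, y v = 0 := by
    intro v hv
    have hvρ := ((hQ v).1 hv).1
    by_cases hpv : p v = ρ
    · rw [(hy v hvρ).1 hpv, if_pos hv]
    · rw [(hy v hvρ).2 hpv, if_pos hv]
  have hyfree : ∀ v ∈ Q, ∀ w ∈ freeChildFinset ρ p Q v, y w =
      (if idx w = 0 then y (p v) + σ v else 0) +
        if 1 ≤ idx w ∧ idx w ≤ j v then f w else 0 := by
    intro v hv w hw
    obtain ⟨hw1, rfl, hw3⟩ := mem_freeChildFinset.1 hw
    rw [(hy w hw1).2 ((hQ _).1 hv).1, if_neg hw3, if_pos hv]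
    by_cases h0 : idx w = 0
    · simp [h0]
    · simp [h0]
  refine ⟨y, isKernelVector h hQ ?_ ?_ ?_, ?_⟩
  · intro v _ hv
    rw [hyQ v hv, branchRatio]
    push_cast
    rw [h2, pow_succ, mul_zero, zero_mul]
  · intro v hvρ hv
    by_cases hpv : p v ∈ Q
    · rw [hyQ _ hpv, hyfree _ hpv v (mem_freeChildFinset.2 ⟨hvρ, rfl, hv⟩), parentRatio,
        if_pos hpv]
      by_cases hj : idx v ≤ j (p v)
      · rw [min_eq_left (by omega), Nat.succ_sub hj, pow_succ]
        push_cast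
        rw [h2, mul_zero, zero_mul]
      · rw [if_neg (by omega), if_neg (by omega), add_zero, mul_zero]
    · have h1 : y v = y (p v) := by
        by_cases hpρ : p v = ρ
        · rw [(hy v hvρ).1 hpρ, if_neg hv, if_neg hpv]
        · rw [(hy v hvρ).2 hpρ, if_neg hv, if_neg hpv]
      rw [parentRatio, if_neg hpv, h1, Nat.cast_one, one_mul]
  · intro v hv
    rw [hyQ v hv, mul_zero, Finset.sum_congr rfl (hyfree v hv), Finset.sum_add_distrib,
      hl.sum_freeChildFinset (fun i => if i = 0 then y (p v) + σ v else 0)]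
    have hpos : 0 < (freeChildFinset ρ p Q v).card := by
      have := hl.le v hv
      omega
    rw [Finset.sum_ite_eq' , if_pos (Finset.mem_range.2 hpos)]
    change 0 = y (p v) + (y (p v) + σ v + σ v)
    linear_combination (-(y (p v)) - σ v) * h2
  · intro v hv
    rw [freeSet, Finset.mem_insert, Finset.mem_biUnion] at hv
    rcases hv with rfl | ⟨u, hu, hv⟩
    · exact hyρ
    · rw [Finset.mem_filter] at hv
      rw [hyfree u hu v hv.1, if_neg (by omega), if_pos hv.2, zero_add]

end

variable {V : Type u} [Fintype V] [DecidableEq V] {ρ : V} {p : V → V} {Q : Finset V}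
  {j idx : V → ℕ} {G : SimpleGraph V} [DecidableRel G.Adj] {depth : V → ℕ}

theorem exists_arithmeticalStructure (hl : IsBranchLabelling ρ p Q j idx)
    (h : G.IsParentMap ρ p depth) (hQ : IsBranchSet ρ p Q) :
    ∃ A : G.ArithmeticalStructure, A.d = fun v => (branchDiagonal ρ p Q j idx v : ℤ) := by
  obtain ⟨r, hrρ, hr⟩ := h.exists_rec_two (1 : ℤ) fun v a b =>
    if v ∈ Q then branchRatio j v * a else if p v ∈ Q then freeRatio p j idx v * b else a
  have hrQ : ∀ v, v ≠ ρ → v ∈ Q → r v = branchRatio j v * r (p v) := by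
    intro v hvρ hv
    by_cases hpv : p v = ρ
    · rw [(hr v hvρ).1 hpv, if_pos hv]
    · rw [(hr v hvρ).2 hpv, if_pos hv]
  have hrfree : ∀ v, v ≠ ρ → v ∉ Q → p v ∈ Q → r v = freeRatio p j idx v * r (p (p v)) := by
    intro v hvρ hv hpv
    rw [(hr v hvρ).2 ((hQ _).1 hpv).1, if_neg hv, if_pos hpv]
  have hreq : ∀ v, v ≠ ρ → v ∉ Q → p v ∉ Q → r v = r (p v) := by
    intro v hvρ hv hpv
    by_cases hpρ : p v = ρ
    · rw [(hr v hvρ).1 hpρ, if_neg hv, if_neg hpv]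
    · rw [(hr v hvρ).2 hpρ, if_neg hv, if_neg hpv]
  have hpos : ∀ v, 0 < r v := fun v => by
    refine (h.top_down (P := fun v => 0 < r v ∧ (v ≠ ρ → 0 < r (p v)))
      (fun v ih => ⟨?_, fun hv => (ih hv).1⟩) v).1
    by_cases hvρ : v = ρ
    · rw [hvρ, hrρ]
      exact one_pos
    obtain ⟨h1, h2⟩ := ih hvρ
    by_cases hv : v ∈ Q
    · rw [hrQ v hvρ hv, branchRatio]
      positivity
    · by_cases hpv : p v ∈ Q
      · have := h2 ((hQ _).1 hpv).1
        rw [hrfree v hvρ hv hpv, freeRatio]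
        positivity
      · rwa [hreq v hvρ hv hpv]
  have hker : G.IsKernelVector (fun v => (branchDiagonal ρ p Q j idx v : ℤ)) r := by
    refine isKernelVector h hQ hrQ ?_ ?_
    · intro v hvρ hv
      by_cases hpv : p v ∈ Q
      · rw [hrfree v hvρ hv hpv, hrQ _ ((hQ _).1 hpv).1 hpv,
          ← freeRatio_mul_parentRatio (idx := idx) (mem_freeChildFinset.2 ⟨hvρ, rfl, hv⟩) hpv]
        push_cast
        ring
      · rw [hreq v hvρ hv hpv, parentRatio, if_neg hpv, Nat.cast_one, one_mul]
    · intro v hv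
      have h1 : ∑ w ∈ freeChildFinset ρ p Q v, r w =
          (∑ w ∈ freeChildFinset ρ p Q v, (freeRatio p j idx w : ℤ)) * r (p v) := by
        rw [Finset.sum_mul]
        refine Finset.sum_congr rfl fun w hw => ?_
        obtain ⟨hw1, rfl, hw3⟩ := mem_freeChildFinset.1 hw
        exact hrfree w hw1 hw3 hv
      have hsum : (1 : ℤ) + ∑ w ∈ freeChildFinset ρ p Q v, (freeRatio p j idx w : ℤ) =
          (((freeChildFinset ρ p Q v).card - j v : ℕ) : ℤ) * branchRatio j v := by
        exact_mod_cast congrArg (Nat.cast (R := ℤ)) (hl.one_add_sum_freeRatio hv)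
      rw [h1, hrQ v ((hQ v).1 hv).1 hv]
      linear_combination -r (p v) * hsum
  refine ⟨⟨_, r, fun v => Int.natCast_nonneg _, hpos, fun m hm => ?_, ?_⟩, rfl⟩
  · have := hm ρ
    rw [hrρ] at this
    exact isUnit_of_dvd_one this
  · ext v
    rw [generalizedLaplacian_mulVec, Pi.zero_apply, sub_eq_zero]
    simpa using hker v

end IsBranchLabelling

theorem IsParentMap.exists_invariantFactorCount {V : Type u} [Fintype V] [DecidableEq V] {ρ : V}
    {p : V → V} {Q : Finset V} {G : SimpleGraph V} [DecidableRel G.Adj] {depth : V → ℕ}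
    (h : G.IsParentMap ρ p depth) (hQ : IsBranchSet ρ p Q) {t : ℕ} (ht : t ≤ branchExcess ρ p Q) :
    ∃ A : G.ArithmeticalStructure, HasInvariantFactorCount A.criticalGroup t := by
  obtain ⟨j, hj, hsum⟩ : ∃ j : V → ℕ, (∀ v ∈ Q, j v ≤ (freeChildFinset ρ p Q v).card - 1) ∧
      ∑ v ∈ Q, j v = t :=
    exists_le_sum_eq Q _ ht
  obtain ⟨idx, hl⟩ := exists_isBranchLabelling ρ p Q j fun v hv => by
    have := hj v hv
    have := ((hQ v).1 hv).2
    omega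
  obtain ⟨A, hA⟩ := hl.exists_arithmeticalStructure h hQ
  obtain ⟨k, hk⟩ := A.exists_hasInvariantFactorCount
  have h1 := A.invariantFactorCount_lt h hk (S := IsBranchLabelling.freeSet ρ p Q j idx)
    fun R _ y hy => hl.eq_zero_of_isKernelVector h hQ (hA ▸ hy)
  have h2 := A.card_le_of_extension h hk (S := IsBranchLabelling.freeSet ρ p Q j idx)
    fun f => hA ▸ hl.exists_isKernelVector_zmod_two h hQ f
  rw [hl.card_freeSet, hsum] at h1 h2
  have hkt : k = t := by omega
  exact ⟨A, hkt ▸ hk⟩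

end SimpleGraph

namespace SimpleGraph

/-! ### Degrees and 2-matchings under starlike splittings -/

/-- The sum of `deg v - 2` over the vertices of degree at least two. -/
noncomputable def degreeExcess {V : Type*} [Fintype V] (G : SimpleGraph V) : ℕ :=
  ∑ v, (G.vertexDegree v - 2)

/-- The handshake lemma with `|E| = |V| - 1`; the truncation in `deg - 2` is off by one exactly at
the leaves. -/
theorem IsTree.leafCount_eq {V : Type*} [Fintype V] {G : SimpleGraph V} (hG : G.IsTree)
    (hV : 2 ≤ Fintype.card V) : G.leafCount = G.degreeExcess + 2 := by
  classical
  have : Nontrivial V := Fintype.one_lt_card_iff_nontrivial.1 hV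
  have hsum := G.sum_degrees_eq_twice_card_edges
  have hcard := hG.card_edgeFinset
  have hleaf : G.leafCount = ∑ v, if G.degree v = 1 then 1 else 0 := by
    rw [leafCount, ← Finset.card_filter, ← Set.ncard_coe_finset]
    congr 1
    ext v
    simp [vertexDegree_eq_degree]
  have hpoint : ∀ v, G.degree v + (if G.degree v = 1 then 1 else 0) = (G.degree v - 2) + 2 := by
    intro v
    have := hG.connected.preconnected.degree_pos_of_nontrivial v
    split_ifs <;> omega
  have htot := Finset.sum_congr rfl fun v (_ : v ∈ Finset.univ) => hpoint v
  rw [Finset.sum_add_distrib, Finset.sum_add_distrib, ← hleaf, hsum, Finset.sum_const,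
    Finset.card_univ, smul_eq_mul] at htot
  simp only [degreeExcess, vertexDegree_eq_degree]
  omega

section

variable {V : Type*} {G : SimpleGraph V}

theorem ncard_incidenceSet (v : V) : (G.incidenceSet v).ncard = G.vertexDegree v := by
  classical
  rw [vertexDegree, ← Nat.card_coe_set_eq, ← Nat.card_coe_set_eq]
  exact Nat.card_congr (G.incidenceSetEquivNeighborSet v)

theorem IsTwoMatching.ncard_add_le [Finite V] {M : Set (Sym2 V)} (hM : G.IsTwoMatching M) (c : V) :
    M.ncard + (G.vertexDegree c - 2) ≤ G.edgeSet.ncard := by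
  have h1 := hM.2 c
  have h2 : G.incidenceSet c \ {e ∈ M | c ∈ e} ⊆ G.edgeSet \ M := fun e he =>
    ⟨he.1.1, fun heM => he.2 ⟨heM, he.1.2⟩⟩
  have h3 := Set.ncard_le_ncard h2 (Set.toFinite _)
  have h0 : {e ∈ M | c ∈ e} ⊆ G.incidenceSet c := fun e he => ⟨hM.1 he.1, he.2⟩
  rw [Set.ncard_sdiff hM.1 (Set.toFinite _), Set.ncard_sdiff h0 (Set.toFinite _),
    ncard_incidenceSet] at h3
  have h4 := Set.ncard_le_ncard hM.1 (Set.toFinite _)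
  omega

/-- Dropping any `deg c - 2` edges at `c` works, so a prescribed edge can be among them. -/
theorem exists_isTwoMatching_of_starlike [Finite V] {c : V} (hc : 3 ≤ G.vertexDegree c)
    (h : ∀ v, v ≠ c → G.vertexDegree v ≤ 2) {e : Sym2 V} (he : e ∈ G.incidenceSet c) :
    ∃ M, G.IsTwoMatching M ∧ e ∉ M ∧ M.ncard + (G.vertexDegree c - 2) = G.edgeSet.ncard := by
  obtain ⟨R, heR, hR, hRcard⟩ := Set.exists_subsuperset_card_eq (n := G.vertexDegree c - 2)
    (Set.singleton_subset_iff.2 he) (by rw [Set.ncard_singleton]; omega)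
    (by rw [ncard_incidenceSet]; omega)
  have hRE : R ⊆ G.edgeSet := hR.trans (G.incidenceSet_subset c)
  refine ⟨G.edgeSet \ R, ⟨Set.sdiff_subset, fun v => ?_⟩, fun h => h.2 (heR rfl), ?_⟩
  · rcases eq_or_ne v c with rfl | hv
    · have h1 : {e ∈ G.edgeSet \ R | v ∈ e} ⊆ G.incidenceSet v \ R := fun e he =>
        ⟨⟨he.1.1, he.2⟩, he.1.2⟩
      refine (Set.ncard_le_ncard h1 (Set.toFinite _)).trans ?_
      rw [Set.ncard_sdiff hR (Set.toFinite _), hRcard, ncard_incidenceSet]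
      omega
    · refine le_trans ?_ (h v hv)
      rw [← ncard_incidenceSet]
      exact Set.ncard_le_ncard (fun e he => ⟨he.1.1, he.2⟩) (Set.toFinite _)
  · rw [Set.ncard_sdiff hRE (Set.toFinite _), hRcard]
    have := Set.ncard_le_ncard hRE (Set.toFinite _)
    omega

theorem twoMatchingNumber_add_degreeExcess [Fintype V]
    (h : ∀ u w, 3 ≤ G.vertexDegree u → 3 ≤ G.vertexDegree w → u = w) :
    G.twoMatchingNumber + G.degreeExcess = G.edgeSet.ncard := by
  obtain ⟨⟨M, hM, hMn⟩, hub⟩ := G.isGreatest_twoMatchingNumber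
  by_cases hex : ∃ c, 3 ≤ G.vertexDegree c
  · obtain ⟨c, hc⟩ := hex
    have hle : ∀ v, v ≠ c → G.vertexDegree v ≤ 2 := fun v hv => by
      by_contra hcon
      exact hv (h v c (by omega) hc)
    have hX : G.degreeExcess = G.vertexDegree c - 2 :=
      Finset.sum_eq_single_of_mem c (Finset.mem_univ c) fun v _ hv => by
        have := hle v hv
        omega
    obtain ⟨e, he⟩ : (G.incidenceSet c).Nonempty := by
      rw [← Set.ncard_pos (Set.toFinite _), ncard_incidenceSet]
      omega
    obtain ⟨M', hM', -, hcard⟩ := exists_isTwoMatching_of_starlike hc hle he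
    have h1 := hub ⟨M', hM', rfl⟩
    have h2 := hM.ncard_add_le c
    omega
  · push Not at hex
    have hX : G.degreeExcess = 0 := Finset.sum_eq_zero fun v _ => by
      have := hex v
      omega
    have h1 := hub ⟨G.edgeSet, ⟨subset_rfl, fun v => ?_⟩, rfl⟩
    · have h2 := hM.ncard_add_le
      have h3 := Set.ncard_le_ncard hM.1 (Set.toFinite _)
      omega
    · have := hex v
      rw [← ncard_incidenceSet] at this
      have h4 : {e ∈ G.edgeSet | v ∈ e} = G.incidenceSet v := rfl
      rw [h4]
      omega

theorem Subgraph.vertexDegree_coe (H : G.Subgraph) (v : H.verts) :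
    H.coe.vertexDegree v = (H.neighborSet v).ncard := by
  rw [vertexDegree, ← Nat.card_coe_set_eq, ← Nat.card_coe_set_eq]
  exact Nat.card_congr (Subgraph.coeNeighborSetEquiv v)

theorem Subgraph.injective_map_coe (H : G.Subgraph) :
    Function.Injective (Sym2.map ((↑) : H.verts → V)) :=
  Sym2.map.injective Subtype.val_injective

theorem Subgraph.ncard_coe_edgeSet (H : G.Subgraph) : H.coe.edgeSet.ncard = H.edgeSet.ncard := by
  rw [← H.image_coe_edgeSet_coe, Set.ncard_image_of_injective _ H.injective_map_coe]

theorem IsTwoMatching.ncard_inter_le [Finite V] {M : Set (Sym2 V)} (hM : G.IsTwoMatching M)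
    (H : G.Subgraph) : (M ∩ H.edgeSet).ncard ≤ H.coe.twoMatchingNumber := by
  have hM' : H.coe.IsTwoMatching (Sym2.map (↑) ⁻¹' (M ∩ H.edgeSet)) := by
    refine ⟨fun e he => ?_, fun v => ?_⟩
    · rw [Subgraph.edgeSet_coe]
      exact he.2
    · refine le_trans ?_ (hM.2 v)
      rw [← Set.ncard_image_of_injective _ H.injective_map_coe]
      refine Set.ncard_le_ncard ?_ (Set.toFinite _)
      rintro _ ⟨e, ⟨he1, he2⟩, rfl⟩
      exact ⟨he1.1, Sym2.mem_map.2 ⟨v, he2, rfl⟩⟩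
  have h1 : Sym2.map (↑) '' (Sym2.map ((↑) : H.verts → V) ⁻¹' (M ∩ H.edgeSet)) =
      M ∩ H.edgeSet := by
    rw [Set.image_preimage_eq_iff]
    intro e he
    have := he.2
    rw [← H.image_coe_edgeSet_coe] at this
    obtain ⟨e', -, rfl⟩ := this
    exact ⟨e', rfl⟩
  rw [← h1, Set.ncard_image_of_injective _ H.injective_map_coe]
  exact H.coe.isGreatest_twoMatchingNumber.2 ⟨_, hM', rfl⟩

theorem Subgraph.ncard_image_inter_le [Finite V] (H : G.Subgraph) {M : Set (Sym2 H.verts)}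
    (hM : H.coe.IsTwoMatching M) (v : V) :
    {e ∈ Sym2.map (↑) '' M | v ∈ e}.ncard ≤ 2 := by
  by_cases hv : v ∈ H.verts
  · have h1 : {e ∈ Sym2.map ((↑) : H.verts → V) '' M | v ∈ e} ⊆
        Sym2.map (↑) '' {e ∈ M | (⟨v, hv⟩ : H.verts) ∈ e} := by
      rintro _ ⟨⟨e, he, rfl⟩, hve⟩
      obtain ⟨w, hw, rfl⟩ := Sym2.mem_map.1 hve
      exact ⟨e, ⟨he, hw⟩, rfl⟩
    exact (Set.ncard_le_ncard h1 (Set.toFinite _)).trans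
      ((Set.ncard_image_le (Set.toFinite _)).trans (hM.2 _))
  · have h1 : {e ∈ Sym2.map ((↑) : H.verts → V) '' M | v ∈ e} = ∅ := by
      rw [Set.eq_empty_iff_forall_notMem]
      rintro _ ⟨⟨e, he, rfl⟩, hve⟩
      obtain ⟨w, hw, rfl⟩ := Sym2.mem_map.1 hve
      exact hv w.2
    rw [h1]
    simp

end

namespace IsStarlikeSplitting

variable {V : Type*} {T : SimpleGraph V} {S T' : T.Subgraph} {s : S.verts} {t : T'.verts}

theorem eq_of_mem (h : T.IsStarlikeSplitting S T' s t) {v : V} (hS : v ∈ S.verts)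
    (hT' : v ∈ T'.verts) : v = s := by
  have : v ∈ S.verts ∩ T'.verts := ⟨hS, hT'⟩
  rw [h.inter] at this
  exact this

theorem disjoint_edgeSet (h : T.IsStarlikeSplitting S T' s t) :
    Disjoint S.edgeSet T'.edgeSet := by
  rw [Set.disjoint_left]
  intro e
  induction e with
  | _ u w =>
  intro hS hT'
  rw [Subgraph.mem_edgeSet] at hS hT'
  have h1 := h.eq_of_mem hS.fst_mem hT'.fst_mem
  have h2 := h.eq_of_mem hS.snd_mem hT'.snd_mem
  exact hS.ne (h1.trans h2.symm)

theorem edgeSet_eq (h : T.IsStarlikeSplitting S T' s t) : T.edgeSet = S.edgeSet ∪ T'.edgeSet := by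
  rw [← Subgraph.edgeSet_sup, h.union, Subgraph.edgeSet_top]

theorem ncard_edgeSet [Finite V] (h : T.IsStarlikeSplitting S T' s t) :
    T.edgeSet.ncard = S.coe.edgeSet.ncard + T'.coe.edgeSet.ncard := by
  rw [h.edgeSet_eq, Set.ncard_union_eq h.disjoint_edgeSet (Set.toFinite _) (Set.toFinite _),
    Subgraph.ncard_coe_edgeSet, Subgraph.ncard_coe_edgeSet]

theorem vertexDegree_eq [Finite V] (h : T.IsStarlikeSplitting S T' s t) (v : V) :
    T.vertexDegree v = (S.neighborSet v).ncard + (T'.neighborSet v).ncard := by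
  rw [vertexDegree, ← Subgraph.neighborSet_top, ← h.union, Subgraph.neighborSet_sup,
    Set.ncard_union_eq _ (Set.toFinite _) (Set.toFinite _)]
  rw [Set.disjoint_left]
  intro w hS hT'
  rw [Subgraph.mem_neighborSet] at hS hT'
  have h1 := h.eq_of_mem hS.fst_mem hT'.fst_mem
  have h2 := h.eq_of_mem hS.snd_mem hT'.snd_mem
  exact hS.ne (h1.trans h2.symm)

/-- Merging raises the degree of `t` by one, which changes the truncated `deg - 2` only if that
degree was at least two. The centre `c` contributes in full, other vertices of `S` nothing. -/
theorem degreeExcess_eq [Fintype V] [Fintype T'.verts] (h : T.IsStarlikeSplitting S T' s t)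
    {c : S.verts} (hc : 3 ≤ S.coe.vertexDegree c) :
    T.degreeExcess = T'.coe.degreeExcess + (S.coe.vertexDegree c - 2) +
      if 1 < T'.coe.vertexDegree t then 1 else 0 := by
  classical
  have hcs : (c : V) ≠ s := by
    intro hcs
    have := h.leaf
    rw [← Subtype.ext hcs] at this
    omega
  have hzero : ∀ (H : T.Subgraph) (v : V), v ∉ H.verts → (H.neighborSet v).ncard = 0 := by
    intro H v hv
    rw [Set.ncard_eq_zero (Set.toFinite _), Set.eq_empty_iff_forall_notMem]
    intro w hw
    rw [Subgraph.mem_neighborSet] at hw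
    exact hv hw.fst_mem
  have hX' : T'.coe.degreeExcess = ∑ v : V, ((T'.neighborSet v).ncard - 2) := by
    rw [degreeExcess, ← Finset.sum_subset (Finset.subset_univ T'.verts.toFinset),
      Finset.sum_subtype T'.verts.toFinset (p := (· ∈ T'.verts)) (by simp)]
    · exact Finset.sum_congr rfl fun v _ => by rw [Subgraph.vertexDegree_coe]
    · intro v _ hv
      rw [hzero T' v (by simpa using hv), Nat.zero_sub]
  have hpoint : ∀ v, T.vertexDegree v - 2 = ((T'.neighborSet v).ncard - 2) +
      (if v = c then S.coe.vertexDegree c - 2 else 0) +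
      if v = s then (if 1 < T'.coe.vertexDegree t then 1 else 0) else 0 := by
    intro v
    rw [h.vertexDegree_eq]
    by_cases hvS : v ∈ S.verts
    · by_cases hvs : v = s
      · have h1 := h.leaf
        rw [Subgraph.vertexDegree_coe] at h1
        have h2 : T'.coe.vertexDegree t = (T'.neighborSet v).ncard := by
          rw [Subgraph.vertexDegree_coe, hvs, h.merged]
        have hvc : v ≠ c := fun h' => hcs (h'.symm.trans hvs)
        rw [if_neg hvc, if_pos hvs, h2, hvs, h1]
        split_ifs <;> omega
      · rw [hzero T' v fun hv => hvs (h.eq_of_mem hvS hv), if_neg hvs]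
        have h1 := S.vertexDegree_coe ⟨v, hvS⟩
        by_cases hvc : v = c
        · have h2 := S.vertexDegree_coe c
          rw [if_pos hvc, hvc, h2]
          omega
        · rw [if_neg hvc]
          have h3 : ¬ 3 ≤ S.coe.vertexDegree ⟨v, hvS⟩ := fun h3 =>
            hvc (congrArg Subtype.val (h.starlike_left.2.unique h3 hc))
          simp only at h1
          omega
    · have hvc : v ≠ c := fun h' => hvS (h' ▸ c.2)
      have hvs : v ≠ s := fun h' => hvS (h' ▸ s.2)
      rw [hzero S v hvS, if_neg hvc, if_neg hvs]
      omega
  rw [degreeExcess, Finset.sum_congr rfl fun v _ => hpoint v, Finset.sum_add_distrib,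
    Finset.sum_add_distrib, ← hX', Finset.sum_ite_eq', Finset.sum_ite_eq']
  simp

/-- A maximum 2-matching of `S` can be chosen without the edge from `s` to `c`. It then leaves the
merged vertex free, so it combines with any 2-matching of `T'`. -/
theorem twoMatchingNumber_eq [Finite V] (h : T.IsStarlikeSplitting S T' s t)
    {c : S.verts} (hc : 3 ≤ S.coe.vertexDegree c) :
    T.twoMatchingNumber + (S.coe.vertexDegree c - 2) =
      T'.coe.twoMatchingNumber + S.coe.edgeSet.ncard := by
  obtain ⟨⟨M, hM, hMn⟩, hub⟩ := T.isGreatest_twoMatchingNumber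
  have hsc : S.coe.Adj s c := by
    obtain ⟨c', hc', hadj⟩ := h.adj_center
    rwa [h.starlike_left.2.unique hc hc']
  obtain ⟨M₁, hM₁, hsM₁, hcard₁⟩ := exists_isTwoMatching_of_starlike hc
    (fun v hv => by
      by_contra hcon
      exact hv (h.starlike_left.2.unique (show 3 ≤ S.coe.vertexDegree v by omega) hc))
    (S.coe.mem_incidence_iff_neighbor.2 (show s ∈ S.coe.neighborSet c from hsc.symm))
  obtain ⟨M₂, hM₂, hcard₂⟩ := T'.coe.isGreatest_twoMatchingNumber.1
  apply le_antisymm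
  · have h1 : M = (M ∩ S.edgeSet) ∪ (M ∩ T'.edgeSet) := by
      rw [← Set.inter_union_distrib_left, ← h.edgeSet_eq]
      exact (Set.inter_eq_left.2 hM.1).symm
    have h2 : M.ncard ≤ (M ∩ S.edgeSet).ncard + (M ∩ T'.edgeSet).ncard := by
      conv_lhs => rw [h1]
      exact Set.ncard_union_le _ _
    have h3 := hM.ncard_inter_le S
    have h4 := hM.ncard_inter_le T'
    obtain ⟨M₃, hM₃, hcard₃⟩ := S.coe.isGreatest_twoMatchingNumber.1
    have h5 := hM₃.ncard_add_le c
    omega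
  · have hE₁ : Sym2.map (↑) '' M₁ ⊆ S.edgeSet := by
      rw [← S.image_coe_edgeSet_coe]
      exact Set.image_mono hM₁.1
    have hE₂ : Sym2.map (↑) '' M₂ ⊆ T'.edgeSet := by
      rw [← T'.image_coe_edgeSet_coe]
      exact Set.image_mono hM₂.1
    have hMM : T.IsTwoMatching (Sym2.map (↑) '' M₁ ∪ Sym2.map (↑) '' M₂) := by
      refine ⟨?_, fun v => ?_⟩
      · rw [h.edgeSet_eq]
        exact Set.union_subset_union hE₁ hE₂
      · by_cases hv : ∃ e ∈ Sym2.map ((↑) : S.verts → V) '' M₁, v ∈ e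
        · refine le_trans (Set.ncard_le_ncard ?_ (Set.toFinite _)) (S.ncard_image_inter_le hM₁ v)
          rintro e ⟨he | he, hve⟩
          · exact ⟨he, hve⟩
          exfalso
          obtain ⟨_, ⟨e₁, he₁, rfl⟩, hve₁⟩ := hv
          obtain ⟨v, hv₁, rfl⟩ := Sym2.mem_map.1 hve₁
          obtain ⟨e₂, he₂, rfl⟩ := he
          obtain ⟨v', -, hv'⟩ := Sym2.mem_map.1 hve
          have hvs : v = s := Subtype.ext (h.eq_of_mem v.2 (hv' ▸ v'.2))
          subst hvs
          obtain ⟨w, rfl⟩ := hv₁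
          have hw : S.coe.Adj v w := hM₁.1 he₁
          have hdeg := h.leaf
          rw [vertexDegree, Set.ncard_eq_one] at hdeg
          obtain ⟨x, hx⟩ := hdeg
          have hwx : w ∈ S.coe.neighborSet v := hw
          have hcx : c ∈ S.coe.neighborSet v := hsc
          rw [hx] at hwx hcx
          rw [Set.mem_singleton_iff] at hwx hcx
          rw [hwx, ← hcx, Sym2.eq_swap] at he₁
          exact hsM₁ he₁
        · refine le_trans (Set.ncard_le_ncard ?_ (Set.toFinite _)) (T'.ncard_image_inter_le hM₂ v)
          rintro e ⟨he | he, hve⟩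
          · exact absurd ⟨e, he, hve⟩ hv
          · exact ⟨he, hve⟩
    have h1 := hub ⟨_, hMM, rfl⟩
    rw [Set.ncard_union_eq (h.disjoint_edgeSet.mono hE₁ hE₂) (Set.toFinite _) (Set.toFinite _),
      Set.ncard_image_of_injective _ S.injective_map_coe,
      Set.ncard_image_of_injective _ T'.injective_map_coe] at h1
    omega

end IsStarlikeSplitting

theorem HasIrregularSplittings.twoMatchingNumber_add {V : Type*} {T : SimpleGraph V} {n : ℕ}
    (h : T.HasIrregularSplittings n) [Fintype V] :
    T.twoMatchingNumber + T.degreeExcess = T.edgeSet.ncard + n := by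
  -- The vertex type varies in the induction, so the `Fintype` instance must be generalized.
  rename_i inst
  revert inst
  induction h with
  | done _ h =>
    intro _
    simpa using twoMatchingNumber_add_degreeExcess h
  | @regular V T S T' s t n h ht _ ih =>
    intro _
    have h0 := @ih (Fintype.ofFinite T'.verts)
    let _ := Fintype.ofFinite T'.verts
    obtain ⟨c, hc, -⟩ := h.adj_center
    have h1 := h.ncard_edgeSet
    have h2 := h.degreeExcess_eq hc
    have h3 := h.twoMatchingNumber_eq hc
    rw [if_neg (by omega)] at h2
    omega
  | @irregular V T S T' s t n h ht _ ih =>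
    intro _
    have h0 := @ih (Fintype.ofFinite T'.verts)
    let _ := Fintype.ofFinite T'.verts
    obtain ⟨c, hc, -⟩ := h.adj_center
    have h1 := h.ncard_edgeSet
    have h2 := h.degreeExcess_eq hc
    have h3 := h.twoMatchingNumber_eq hc
    rw [if_pos ht] at h2
    omega

end SimpleGraph

namespace SimpleGraph

/-! ### Existence of starlike decompositions -/

section

variable {V : Type*} {G : SimpleGraph V} {ρ : V} {p : V → V} {depth : V → ℕ}

theorem IsParentMap.exists_descendants (h : G.IsParentMap ρ p depth) {c : V} (hc : c ≠ ρ) :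
    ∃ D : Set V, ρ ∉ D ∧ c ∈ D ∧ p c ∉ D ∧ (∀ v, v ≠ ρ → (v ∈ D ↔ v = c ∨ p v ∈ D)) ∧
      ∀ v ∈ D, v = c ∨ depth c < depth v := by
  obtain ⟨D, hρ, hD⟩ := h.exists_rec False fun v x => v = c ∨ x
  have hmem : ∀ v, v ≠ ρ → (D v ↔ v = c ∨ D (p v)) := fun v hv => (hD v hv).to_iff
  have hdepth : ∀ v, D v → v = c ∨ depth c < depth v := by
    refine h.top_down fun v ih hv => ?_
    have hvρ : v ≠ ρ := fun h' => by
      rw [h', hρ] at hv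
      exact hv
    rcases (hmem v hvρ).1 hv with h1 | h1
    · exact Or.inl h1
    · have h2 := h.depth_lt v hvρ
      rcases ih hvρ h1 with h3 | h3
      · right
        rwa [← h3]
      · exact Or.inr (h3.trans h2)
  refine ⟨{v | D v}, ?_, (hmem c hc).2 (Or.inl rfl), ?_, hmem, hdepth⟩
  · change ¬ D ρ
    rw [hρ]
    exact id
  · intro hpc
    have h1 := h.depth_lt c hc
    rcases hdepth _ hpc with h2 | h2
    · rw [h2] at h1
      exact lt_irrefl _ h1
    · omega

theorem IsParentMap.depth_root_lt (h : G.IsParentMap ρ p depth) :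
    ∀ v, v ≠ ρ → depth ρ < depth v := by
  refine h.top_down fun v ih hv => ?_
  have h1 := h.depth_lt v hv
  by_cases hpv : p v = ρ
  · rwa [hpv] at h1
  · exact (ih hv hpv).trans h1

/-- Root at the branching vertex `u` and take a branching vertex `c` of maximal depth. `S` is the
subtree below `c` together with the parent of `c`, and no vertex strictly below `c` branches.
Rooting at `u` ensures that the parent of `c` keeps a neighbour in `T'`, even when it is the root.
-/
theorem IsTree.exists_isStarlikeSplitting [Finite V] (hG : G.IsTree) {u w : V} (huw : u ≠ w)
    (hu : 3 ≤ G.vertexDegree u) (hw : 3 ≤ G.vertexDegree w) :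
    ∃ (S T' : G.Subgraph) (s : S.verts) (t : T'.verts), G.IsStarlikeSplitting S T' s t ∧
      1 ≤ T'.coe.vertexDegree t ∧ T'.verts ≠ Set.univ := by
  obtain ⟨p, depth, h⟩ := hG.exists_isParentMap u
  obtain ⟨c, hc, hmax⟩ := Set.exists_max_image {v | 3 ≤ G.vertexDegree v} depth (Set.toFinite _)
    ⟨w, hw⟩
  have hcu : c ≠ u := by
    rintro rfl
    have h1 := h.depth_root_lt w huw.symm
    have h2 := hmax w hw
    omega
  obtain ⟨D, hρD, hcD, hpcD, hD, hdepth⟩ := h.exists_descendants hcu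
  have hDu : ∀ v ∈ D, v ≠ u := fun v hv h' => hρD (h' ▸ hv)
  let S : G.Subgraph := (⊤ : G.Subgraph).induce (insert (p c) D)
  let T' : G.Subgraph := (⊤ : G.Subgraph).induce Dᶜ
  have hSadj : ∀ a b, S.Adj a b ↔ (a = p c ∨ a ∈ D) ∧ (b = p c ∨ b ∈ D) ∧ G.Adj a b :=
    fun a b => Iff.rfl
  have hTadj : ∀ a b, T'.Adj a b ↔ a ∉ D ∧ b ∉ D ∧ G.Adj a b := fun a b => Iff.rfl
  have hparent : ∀ v ∈ D, p v = p c ∨ p v ∈ D := by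
    intro v hv
    rcases (hD v (hDu v hv)).1 hv with rfl | h1
    · exact Or.inl rfl
    · exact Or.inr h1
  have hparent' : ∀ v, v ≠ u → v ∉ D → p v ∉ D := fun v hvu hv hpv =>
    hv ((hD v hvu).2 (Or.inr hpv))
  have hnbr : ∀ v ∈ D, ∀ x, G.Adj v x → x = p c ∨ x ∈ D := by
    intro v hv x hvx
    rcases (h.adj_iff v x).1 hvx with ⟨-, rfl⟩ | ⟨hx, rfl⟩
    · exact hparent v hv
    · exact Or.inr ((hD x hx).2 (Or.inr hv))
  have hnbrc : ∀ x ∈ D, G.Adj (p c) x → x = c := by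
    intro x hx hadj
    rcases (h.adj_iff _ _).1 hadj with ⟨hpu, rfl⟩ | ⟨hxu, hpx⟩
    · exact absurd hx (hparent' _ hpu hpcD)
    · refine ((hD x hxu).1 hx).resolve_right fun h1 => hpcD ?_
      rwa [hpx] at h1
  have hcadj : G.Adj c (p c) := h.parent_adj hcu
  let s : S.verts := ⟨p c, Or.inl rfl⟩
  let t : T'.verts := ⟨p c, hpcD⟩
  let c' : S.verts := ⟨c, Or.inr hcD⟩
  have hdegD : ∀ v (hv : v ∈ D), S.coe.vertexDegree ⟨v, Or.inr hv⟩ = G.vertexDegree v := by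
    intro v hv
    rw [Subgraph.vertexDegree_coe, vertexDegree]
    congr 1
    ext x
    simp only [Subgraph.mem_neighborSet, mem_neighborSet, hSadj]
    exact ⟨fun h1 => h1.2.2, fun h1 => ⟨Or.inr hv, hnbr v hv x h1, h1⟩⟩
  have hleaf : S.coe.vertexDegree s = 1 := by
    rw [Subgraph.vertexDegree_coe, Set.ncard_eq_one]
    refine ⟨c, ?_⟩
    ext x
    simp only [Subgraph.mem_neighborSet, Set.mem_singleton_iff, hSadj, s]
    constructor
    · rintro ⟨-, rfl | hx, hadj⟩
      · exact absurd hadj G.irrefl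
      · exact hnbrc x hx hadj
    · rintro rfl
      exact ⟨Or.inl trivial, Or.inr hcD, hcadj.symm⟩
  have hreachS : ∀ v (hv : v ∈ D), S.coe.Reachable c' ⟨v, Or.inr hv⟩ := by
    refine h.top_down fun v ih hv => ?_
    rcases (hD v (hDu v hv)).1 hv with rfl | h1
    · exact Reachable.refl _
    · refine (ih (hDu v hv) h1).trans (Adj.reachable ?_)
      exact ⟨Or.inr h1, Or.inr hv, (h.parent_adj (hDu v hv)).symm⟩
  have hreachT : ∀ v (hv : v ∉ D), T'.coe.Reachable ⟨u, hρD⟩ ⟨v, hv⟩ := by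
    refine h.top_down fun v ih hv => ?_
    by_cases hvu : v = u
    · subst hvu
      exact Reachable.refl _
    · refine (ih hvu (hparent' v hvu hv)).trans (Adj.reachable ?_)
      exact ⟨hparent' v hvu hv, hv, (h.parent_adj hvu).symm⟩
  have hsplit : G.IsStarlikeSplitting S T' s t := by
    refine ⟨hG, ⟨u, w, huw, hu, hw⟩, ⟨⟨?_, hG.isAcyclic.subgraph S⟩, c', ?_, ?_⟩,
      ⟨?_, hG.isAcyclic.subgraph T'⟩, hleaf, ⟨c', ?_, ?_⟩, rfl, ?_, ?_⟩
    · refine (connected_iff_exists_forall_reachable _).2 ⟨c', ?_⟩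
      rintro ⟨v, rfl | hv⟩
      · exact Adj.reachable ⟨Or.inr hcD, Or.inl rfl, hcadj⟩
      · exact hreachS v hv
    · change 3 ≤ S.coe.vertexDegree c'
      rw [hdegD c hcD]
      exact hc
    · rintro ⟨v, rfl | hv⟩ hdeg
      · change 3 ≤ S.coe.vertexDegree s at hdeg
        omega
      · rw [hdegD v hv] at hdeg
        refine Subtype.ext ((hdepth v hv).resolve_right fun h1 => ?_)
        have := hmax v hdeg
        omega
    · exact (connected_iff_exists_forall_reachable _).2 ⟨⟨u, hρD⟩, fun v => hreachT v v.2⟩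
    · rw [hdegD c hcD]
      exact hc
    · exact ⟨Or.inl rfl, Or.inr hcD, hcadj.symm⟩
    · ext v
      simp only [S, T', s, Subgraph.induce_verts, Set.mem_inter_iff, Set.mem_insert_iff,
        Set.mem_compl_iff, Set.mem_singleton_iff]
      constructor
      · rintro ⟨h1 | h1, h2⟩
        · exact h1
        · exact absurd h1 h2
      · rintro rfl
        exact ⟨Or.inl rfl, hpcD⟩
    · ext a b
      · simp only [S, T', Subgraph.verts_sup, Subgraph.induce_verts, Set.mem_union,
          Set.mem_insert_iff, Set.mem_compl_iff, Subgraph.verts_top, Set.mem_univ, iff_true]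
        tauto
      · rw [Subgraph.sup_adj, hSadj, hTadj, Subgraph.top_adj]
        constructor
        · rintro (h1 | h1)
          · exact h1.2.2
          · exact h1.2.2
        · intro hab
          by_cases ha : a ∈ D
          · exact Or.inl ⟨Or.inr ha, hnbr a ha b hab, hab⟩
          · by_cases hb : b ∈ D
            · exact Or.inl ⟨hnbr b hb a hab.symm, Or.inr hb, hab⟩
            · exact Or.inr ⟨ha, hb, hab⟩
  refine ⟨S, T', s, t, hsplit, ?_, fun h1 => ?_⟩
  · by_cases hpc : p c = u
    · have h1 := hsplit.vertexDegree_eq (p c)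
      have h2 := Subgraph.vertexDegree_coe S s
      have h3 := Subgraph.vertexDegree_coe T' t
      have h4 : 3 ≤ G.vertexDegree (p c) := hpc ▸ hu
      simp only [s, t] at h2 h3
      change S.coe.vertexDegree s = _ at h2
      change T'.coe.vertexDegree t = _ at h3
      omega
    · rw [Nat.one_le_iff_ne_zero, Subgraph.vertexDegree_coe, Ne, Set.ncard_eq_zero (Set.toFinite _)]
      refine Set.Nonempty.ne_empty ⟨p (p c), ?_⟩
      exact ⟨hpcD, hparent' _ hpc hpcD, h.parent_adj hpc⟩
  · have : c ∈ T'.verts := h1 ▸ Set.mem_univ c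
    exact this hcD

end

theorem IsTree.exists_hasIrregularSplittings {V : Type u} [Finite V] {T : SimpleGraph V}
    (hT : T.IsTree) : ∃ n, T.HasIrregularSplittings n := by
  induction hn : Nat.card V using Nat.strong_induction_on generalizing V with
  | _ n ih =>
  by_cases hbig : ∀ u w, 3 ≤ T.vertexDegree u → 3 ≤ T.vertexDegree w → u = w
  · exact ⟨0, .done hT hbig⟩
  · push Not at hbig
    obtain ⟨u, w, hu, hw, huw⟩ := hbig
    obtain ⟨S, T', s, t, hsplit, hdeg, hne⟩ := hT.exists_isStarlikeSplitting huw hu hw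
    have hcard : Nat.card T'.verts < n := by
      rw [← hn, Nat.card_coe_set_eq, ← Set.ncard_univ]
      exact Set.ncard_lt_ncard (Set.ssubset_univ_iff.2 hne) (Set.toFinite _)
    obtain ⟨m, hm⟩ := ih _ hcard hsplit.isTree_right rfl
    rcases hdeg.eq_or_lt with h1 | h1
    · exact ⟨m, .regular hsplit h1.symm hm⟩
    · exact ⟨m + 1, .irregular hsplit h1 hm⟩

end SimpleGraph

/-! ### Assembly of the bound, its sharpness and the independence of the splitting sequence -/

theorem theorem5p5 {V : Type u} [Fintype V] [DecidableEq V] (T : SimpleGraph V)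
    [DecidableRel T.Adj] (hT : T.IsTree) (hV : 2 ≤ Fintype.card V) :
    -- `ι(T)` is well defined: sequences of starlike splittings decomposing `T` exist,
    -- and all of them have exactly `ι(T)` irregular splittings
    (∀ n : ℕ, T.HasIrregularSplittings n ↔ n = T.splittingIrregularityNumber) ∧
    -- the two forms of the bound agree
    ((T.leafCount : ℤ) - 2 - T.splittingIrregularityNumber =
      (T.edgeSet.ncard : ℤ) - T.twoMatchingNumber) ∧
    -- every critical group has a number of invariant factors, and it is at most the bound
    (∀ A : T.ArithmeticalStructure,
      (∃ k : ℕ, HasInvariantFactorCount A.criticalGroup k) ∧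
      ∀ k : ℕ, HasInvariantFactorCount A.criticalGroup k →
        (k : ℤ) ≤ (T.leafCount : ℤ) - 2 - T.splittingIrregularityNumber ∧
        (k : ℤ) ≤ (T.edgeSet.ncard : ℤ) - T.twoMatchingNumber) ∧
    -- every number up to the bound is realized
    (∀ t : ℕ, (t : ℤ) ≤ (T.leafCount : ℤ) - T.splittingIrregularityNumber - 2 →
      ∃ A : T.ArithmeticalStructure, HasInvariantFactorCount A.criticalGroup t) := by
  obtain ⟨n₀, hn₀⟩ := hT.exists_hasIrregularSplittings
  have hι : T.HasIrregularSplittings T.splittingIrregularityNumber := Nat.sInf_mem ⟨n₀, hn₀⟩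
  -- All other terms of this identity depend only on `T`, so it determines `n`.
  have hformula := fun n (hn : T.HasIrregularSplittings n) => hn.twoMatchingNumber_add
  have hleaf := hT.leafCount_eq hV
  have hιf := hformula _ hι
  have : Nontrivial V := Fintype.one_lt_card_iff_nontrivial.1 hV
  obtain ⟨ρ, hρ⟩ := hT.exists_vert_degree_one_of_nontrivial
  obtain ⟨p, depth, h⟩ := hT.exists_isParentMap ρ
  obtain ⟨Q, hQ⟩ := h.exists_isBranchSet
  have hfree := fun v hv => h.card_freeChildFinset_le_one (v := v) hQ hρ hv
  have hbranch := h.twoMatchingNumber_add_branchExcess hQ hfree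
  obtain ⟨S, hS, hdet⟩ := h.exists_determining_finset hQ hfree
  refine ⟨fun n => ⟨fun hn => ?_, fun hn => hn ▸ hι⟩, by omega, fun A =>
    ⟨A.exists_hasInvariantFactorCount, fun k hk => ?_⟩, fun t ht =>
      h.exists_invariantFactorCount hQ (by omega)⟩
  · have := hformula n hn
    omega
  · have := A.invariantFactorCount_lt h hk (S := S) fun R _ y hy => hdet R A.d y hy
    omega
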